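/- **Setting.** Let $\mathcal M=\{x\in\mathbb R^{d_1\times r}: x^\top x=I_r\}$ be the Stiefel manifold, let $\|\cdot\|$ be the Frobenius (Euclidean) norm, $A(x)=x(\tfrac32 I_r-\tfrac12x^\top x)$, $c(x)=x^\top x-I_r$, $C>\tfrac12+\sup_{x\in\mathcal M}\|x\|$, $X=\{x:\|x\|\le C\}$ and $\bar X=A(X)$. Consider $\min_{x\in\mathcal M}\max_{y\in\mathbb R^{d_2}} f(x,y)-h(y)$, where (i) $h:\mathbb R^{d_2}\to\mathbb R\cup\{+\infty\}$ is proper, closed, convex and locally Lipschitz on $Y=\operatorname{dom}h$, which is closed, bounded and has diameter $D_Y>0$; (ii) $f$ is differentiable on an open set containing $\bar X\times Y$ and $\nabla_xf,\nabla_yf$ are Lipschitz on $\bar X\times Y$; (iii) $f(x,y)+\langle\nabla_yf(x,y),w-y\rangle\ge f(x,w)$ for all $x\in\bar X$ and $y,w\in Y$. A pair $(x,y)\in\mathcal M\times Y$ is $\epsilon$-stationary if $\|\operatorname{grad}_xf(x,y)\|\le\epsilon$ and $\operatorname{dist}(0,-\nabla_yf(x,y)+\partial h(y))\le\epsilon$,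 where $\operatorname{grad}_xf(x,y)=\nabla_xf(x,y)-x\operatorname{sym}(x^\top\nabla_xf(x,y))$ is the partial Riemannian gradient. It is stationary if $\operatorname{grad}_xf(x,y)=0$ and $0\in-\nabla_yf(x,y)+\partial h(y)$. Fix an anchor $\bar y\in Y$. For $\epsilon>0$ put $f^\epsilon(x,y)=f(x,y)-\frac{\epsilon}{4D_Y}\|y-\bar y\|^2$ and $\mu=\frac{\epsilon}{2D_Y}$. For $\rho>0$ put $\tilde f(x,y)=f(A(x),y)+\frac\rho4\|c(x)\|^2$, and define $\tilde f^\epsilon$ in the same way from $f^\epsilon$. A number $l>0$ is a *Lipschitz constant* for $\tilde f$ if each of $\|\nabla_x\tilde f(x_1,y_1)-\nabla_x\tilde f(x_2,y_2)\|$ and $\|\nabla_y\tilde f(x_1,y_1)-\nabla_y\tilde f(x_2,y_2)\|$ is at most $l\|x_1-x_2\|+l\|y_1-y_2\|$ on $X\times Y$, and likewise for $\tilde f^\epsilon$. **Algorithm (sm-MGDA applied to $f^\epsilon-h$).** Let $l$ be a Lipschitz constant for $\tilde f^\epsilon$, $p=2l$, $\tau_1=s/l$ with $s\in(0,\tfrac13]$,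 $\tau_2=\frac1{16}(3/\tau_1)^{-1}$ and $\beta=\alpha\min\{\mu,l\}\tau_2$ with $\alpha\in(0,\frac1{2306})$. For $t\ge0$, $$x_{t+1}=\mathcal P_X\big(x_t-\tau_1(\nabla_x\tilde f^\epsilon(x_t,y_t)+p(x_t-z_t))\big),\quad y_{t+1}=\operatorname{prox}_{\tau_2h}\big(y_t+\tau_2\nabla_y f^\epsilon(A(x_{t+1}),y_t)\big),\quad z_{t+1}=z_t+\beta(x_{t+1}-z_t).$$ With $\hat f^\epsilon(x,y;z)=\tilde f^\epsilon(x,y)+\frac p2\|x-z\|^2$, the run starts from $z_0\in\mathcal M$, $y_0\in\arg\max_y\{\min_{x\in X}\hat f^\epsilon(x,y;z_0)-h(y)\}$, and either $x_0=z_0$ or $x_0\in\arg\min_{x\in X}\max_y\{\hat f^\epsilon(x,y;z_0)-h(y)\}$. **Claim.** 1. For every $\epsilon>0$ and $x\in\bar X$, the function $f^\epsilon(x,\cdot)-h$ is strongly concave on $Y$ with modulus $\mu=\frac{\epsilon}{2D_Y}$. 2. For every $\rho>0$ a Lipschitz constant for $\tilde f$ exists; and if $l$ is one, then $l+\frac{\epsilon}{2D_Y}$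 is a Lipschitz constant for $\tilde f^\epsilon$, for every $\epsilon>0$. 3. For every $\epsilon_0>0$ and $z_0\in\mathcal M$ there is $\bar\rho>0$ such that for all $s\in(0,\frac13]$ and $\alpha\in(0,\frac1{2306})$ there is $K>0$, independent of $\rho$, $l$ and $\epsilon$, such that for all $\rho\ge\bar\rho$, all $\epsilon\in(0,\epsilon_0]$ and every Lipschitz constant $l$ for $\tilde f^\epsilon$: a run from $z_0$ exists, and every such run has an iterate $(x_t,y_t)$ with $t\le K\,l^2\epsilon^{-3}$ such that the projection $\mathcal P_{\mathcal M}(x_t)$ is unique, $\|x_t-\mathcal P_{\mathcal M}(x_t)\|\le\frac3\rho\epsilon$, and $(\mathcal P_{\mathcal M}(x_t),y_t)$ is an $\epsilon$-stationary point of the original, unregularized problem. 4. Asymptotic stationarity for the original problem is lost: for all $d_1$, $r$, all $d_2\ge1$ and all $C$ as above there are $f,h$ satisfying (i)–(iii) and an anchor $\bar y\in Y$ such that for all $\epsilon,\rho>0$ and all $l,s,\alpha$ as above, every run of the algorithm has a limit point $(x^*,y^*)$ of $\{(x_t,y_t)\}$, and none of its limit points is stationary for the original problem. -/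

import Mathlib

noncomputable section

namespace SmMGDA

/-! ### Matrices with the Frobenius inner product, and the Stiefel manifold -/

/-- `m × n` real matrices with the Frobenius norm and inner product (the Euclidean structure on
the entries). -/
abbrev Mat (m n : ℕ) := EuclideanSpace ℝ (Fin m × Fin n)

/-- The dual space `ℝ^d`. -/
abbrev Vec (d : ℕ) := EuclideanSpace ℝ (Fin d)

/-- The array of entries, as a Mathlib matrix. -/
def toM {m n : ℕ} (x : Mat m n) : Matrix (Fin m) (Fin n) ℝ := Matrix.of fun i j => x (i, j)

/-- The inverse of `toM`. -/
def ofM {m n : ℕ} (M : Matrix (Fin m) (Fin n) ℝ) : Mat m n :=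
  WithLp.toLp 2 fun ij => M ij.1 ij.2

/-- The symmetric part `(B + Bᵀ) / 2`. -/
def symPart {n : ℕ} (B : Matrix (Fin n) (Fin n) ℝ) : Matrix (Fin n) (Fin n) ℝ :=
  (1 / 2 : ℝ) • (B + B.transpose)

/-- The constraint map `c(x) = xᵀ x - I`. -/
def cMap {d r : ℕ} (x : Mat d r) : Mat r r := ofM ((toM x).transpose * toM x - 1)

/-- The Stiefel manifold `{x | xᵀ x = I}`. -/
def stiefel (d r : ℕ) : Set (Mat d r) := {x | (toM x).transpose * toM x = 1}

/-- The constraint dissolving map `A(x) = x (3/2 I - 1/2 xᵀ x)`. -/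
def AMap {d r : ℕ} (x : Mat d r) : Mat d r :=
  ofM (toM x * ((3 / 2 : ℝ) • (1 : Matrix (Fin r) (Fin r) ℝ)
    - (1 / 2 : ℝ) • ((toM x).transpose * toM x)))

/-- `∇A(x)[u] = u (3/2 I - 1/2 xᵀ x) - x sym(xᵀ u)`. -/
def gradA {d r : ℕ} (x u : Mat d r) : Mat d r :=
  ofM (toM u * ((3 / 2 : ℝ) • (1 : Matrix (Fin r) (Fin r) ℝ)
      - (1 / 2 : ℝ) • ((toM x).transpose * toM x))
    - toM x * symPart ((toM x).transpose * toM u))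

/-- `∇c(x)[u] = 2 x u`. -/
def gradC {d r : ℕ} (x : Mat d r) (u : Mat r r) : Mat d r :=
  ofM ((2 : ℝ) • (toM x * toM u))

/-- The ball `X = {x | ‖x‖ ≤ C}` in the Frobenius norm. -/
def ballX (d r : ℕ) (C : ℝ) : Set (Mat d r) := {x | ‖x‖ ≤ C}

/-- `X̄ = {A(x) | ‖x‖ ≤ C}`. -/
def barX (d r : ℕ) (C : ℝ) : Set (Mat d r) := AMap '' ballX d r C

/-- `p` is a nearest point of `S` to `u`. -/
def IsProj {E : Type*} [NormedAddCommGroup E] (S : Set E) (u p : E) : Prop :=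
  p ∈ S ∧ ∀ q ∈ S, ‖u - p‖ ≤ ‖u - q‖

/-! ### The regularizer -/

/-- The effective domain of an extended-real-valued function. -/
def dom {d : ℕ} (h : Vec d → EReal) : Set (Vec d) := {y | h y < ⊤}

/-- The subdifferential of a convex function. -/
def subdiff {d : ℕ} (h : Vec d → EReal) (y : Vec d) : Set (Vec d) :=
  {g | ∀ w, h y + ((inner ℝ g (w - y) : ℝ) : EReal) ≤ h w}

/-- `p` minimizes `τ h + 1/2 ‖· - u‖²`, that is, `p = prox_{τ h}(u)`. -/
def IsProx {d : ℕ} (τ : ℝ) (h : Vec d → EReal) (u p : Vec d) : Prop :=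
  ∀ w, (τ : EReal) * h p + ((‖p - u‖ ^ 2 / 2 : ℝ) : EReal)
    ≤ (τ : EReal) * h w + ((‖w - u‖ ^ 2 / 2 : ℝ) : EReal)

/-- `h` is proper, closed and convex, locally Lipschitz on its domain, and its domain is closed
and bounded. -/
structure IsRegularizer {d : ℕ} (h : Vec d → EReal) : Prop where
  ne_bot : ∀ y, h y ≠ ⊥
  nonempty_dom : (dom h).Nonempty
  lsc : LowerSemicontinuous h
  convex_epigraph : Convex ℝ {q : Vec d × ℝ | h q.1 ≤ (q.2 : EReal)}
  isClosed_dom : IsClosed (dom h)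
  isBounded_dom : Bornology.IsBounded (dom h)
  locallyLipschitz : LocallyLipschitzOn (dom h) fun y => (h y).toReal

/-! ### The coupling function -/

/-- The partial gradient in `x`. -/
def gradX {d r e : ℕ} (f : Mat d r → Vec e → ℝ) (x : Mat d r) (y : Vec e) : Mat d r :=
  gradient (fun x' => f x' y) x

/-- The partial gradient in `y`. -/
def gradY {d r e : ℕ} (f : Mat d r → Vec e → ℝ) (x : Mat d r) (y : Vec e) : Vec e :=
  gradient (fun y' => f x y') y

/-- `f` is differentiable on an open set containing `X̄ × Y` and its partial gradients are
Lipschitz on `X̄ × Y`. -/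
def IsSmooth {d r e : ℕ} (C : ℝ) (f : Mat d r → Vec e → ℝ) (Y : Set (Vec e)) : Prop :=
  (∃ U : Set (Mat d r × Vec e), IsOpen U ∧ barX d r C ×ˢ Y ⊆ U ∧
    DifferentiableOn ℝ (fun q : Mat d r × Vec e => f q.1 q.2) U) ∧
  ∃ Lxx Lxy Lyx Lyy : ℝ, 0 ≤ Lxx ∧ 0 ≤ Lxy ∧ 0 ≤ Lyx ∧ 0 ≤ Lyy ∧
    ∀ x₁ ∈ barX d r C, ∀ x₂ ∈ barX d r C, ∀ y₁ ∈ Y, ∀ y₂ ∈ Y,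
      ‖gradX f x₁ y₁ - gradX f x₂ y₂‖ ≤ Lxx * ‖x₁ - x₂‖ + Lxy * ‖y₁ - y₂‖ ∧
      ‖gradY f x₁ y₁ - gradY f x₂ y₂‖ ≤ Lyx * ‖x₁ - x₂‖ + Lyy * ‖y₁ - y₂‖

/-- `f(x, ·)` is merely concave on `Y` for every `x ∈ X̄`. -/
def IsMerelyConcave {d r e : ℕ} (C : ℝ) (f : Mat d r → Vec e → ℝ) (Y : Set (Vec e)) : Prop :=
  ∀ x ∈ barX d r C, ∀ y ∈ Y, ∀ w ∈ Y, f x w ≤ f x y + inner ℝ (gradY f x y) (w - y)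

/-- The standing assumptions in the merely concave case; the domain of `h` is assumed to have
more than one point, so that its diameter is positive. -/
structure IsInstance {d r e : ℕ} (C : ℝ) (f : Mat d r → Vec e → ℝ) (h : Vec e → EReal) :
    Prop where
  regularizer : IsRegularizer h
  nontrivial_dom : (dom h).Nontrivial
  smooth : IsSmooth C f (dom h)
  concave : IsMerelyConcave C f (dom h)

/-- The Tikhonov regularization `f(x, y) - ε / (4 D) ‖y - a‖²`, where `D` is the diameter of the
domain of `h` and `a` is the anchor. -/
def tikhonov {d r e : ℕ} (f : Mat d r → Vec e → ℝ) (h : Vec e → EReal) (a : Vec e) (ε : ℝ) :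
    Mat d r → Vec e → ℝ :=
  fun x y => f x y - ε / (4 * Metric.diam (dom h)) * ‖y - a‖ ^ 2

/-! ### Stationarity on the manifold -/

/-- The partial Riemannian gradient `∇ₓ f(x, y) - x sym(xᵀ ∇ₓ f(x, y))`. -/
def riemGradX {d r e : ℕ} (f : Mat d r → Vec e → ℝ) (x : Mat d r) (y : Vec e) : Mat d r :=
  gradX f x y - ofM (toM x * symPart ((toM x).transpose * toM (gradX f x y)))

/-- The set `-∇_y f(x, y) + ∂h(y)`. -/
def dualResidual {d r e : ℕ} (f : Mat d r → Vec e → ℝ) (h : Vec e → EReal)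
    (x : Mat d r) (y : Vec e) : Set (Vec e) :=
  (fun g => -gradY f x y + g) '' subdiff h y

/-- Stationary points of `min_{x ∈ M} max_y f(x, y) - h(y)`. -/
def IsStationary {d r e : ℕ} (f : Mat d r → Vec e → ℝ) (h : Vec e → EReal)
    (x : Mat d r) (y : Vec e) : Prop :=
  x ∈ stiefel d r ∧ y ∈ dom h ∧ riemGradX f x y = 0 ∧ (0 : Vec e) ∈ dualResidual f h x y

/-- `ε`-stationary points of `min_{x ∈ M} max_y f(x, y) - h(y)`. The distance to the empty set
is infinite. -/
def IsEpsStationary {d r e : ℕ} (f : Mat d r → Vec e → ℝ) (h : Vec e → EReal) (ε : ℝ)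
    (x : Mat d r) (y : Vec e) : Prop :=
  x ∈ stiefel d r ∧ y ∈ dom h ∧ ‖riemGradX f x y‖ ≤ ε ∧
    Metric.infEDist (0 : Vec e) (dualResidual f h x y) ≤ ENNReal.ofReal ε

/-! ### The penalized problem and the algorithm -/

/-- `f̃(x, y) = f(A(x), y) + ρ/4 ‖c(x)‖²`. -/
def penalized {d r e : ℕ} (f : Mat d r → Vec e → ℝ) (ρ : ℝ) : Mat d r → Vec e → ℝ :=
  fun x y => f (AMap x) y + ρ / 4 * ‖cMap x‖ ^ 2

/-- `l` is a Lipschitz constant of the gradient of the penalized function over `X × dom h`: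
it bounds all four partial Lipschitz constants. -/
def IsPenLip {d r e : ℕ} (C : ℝ) (f : Mat d r → Vec e → ℝ) (h : Vec e → EReal) (ρ l : ℝ) :
    Prop :=
  ∀ x₁ ∈ ballX d r C, ∀ x₂ ∈ ballX d r C, ∀ y₁ ∈ dom h, ∀ y₂ ∈ dom h,
    ‖gradX (penalized f ρ) x₁ y₁ - gradX (penalized f ρ) x₂ y₂‖
      ≤ l * ‖x₁ - x₂‖ + l * ‖y₁ - y₂‖ ∧
    ‖gradY (penalized f ρ) x₁ y₁ - gradY (penalized f ρ) x₂ y₂‖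
      ≤ l * ‖x₁ - x₂‖ + l * ‖y₁ - y₂‖

/-- `f̂(x, y; z) = f̃(x, y) + p/2 ‖x - z‖²`. -/
def smoothed {d r e : ℕ} (f : Mat d r → Vec e → ℝ) (ρ p : ℝ) (x : Mat d r) (y : Vec e)
    (z : Mat d r) : ℝ :=
  penalized f ρ x y + p / 2 * ‖x - z‖ ^ 2

/-- `Φ(x; z) = max_y f̂(x, y; z) - h(y)`. -/
def primalFun {d r e : ℕ} (f : Mat d r → Vec e → ℝ) (h : Vec e → EReal) (ρ p : ℝ)
    (x z : Mat d r) : EReal :=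
  ⨆ y : Vec e, ((smoothed f ρ p x y z : ℝ) : EReal) - h y

/-- `Ψ_r(y; z) = min_{x ∈ X} f̂(x, y; z) - h(y)`. -/
def dualFun {d r e : ℕ} (C : ℝ) (f : Mat d r → Vec e → ℝ) (h : Vec e → EReal) (ρ p : ℝ)
    (y : Vec e) (z : Mat d r) : EReal :=
  (⨅ x ∈ ballX d r C, ((smoothed f ρ p x y z : ℝ) : EReal)) - h y

/-- Admissible initial points: `z₀ ∈ M`, `y₀` maximizes `Ψ_r(·; z₀)`, and either `x₀ = z₀` or
`x₀` minimizes `Φ(·; z₀)` over `X`. -/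
def IsInit {d r e : ℕ} (C : ℝ) (f : Mat d r → Vec e → ℝ) (h : Vec e → EReal) (ρ p : ℝ)
    (x₀ : Mat d r) (y₀ : Vec e) (z₀ : Mat d r) : Prop :=
  z₀ ∈ stiefel d r ∧
  (y₀ ∈ dom h ∧ ∀ w, dualFun C f h ρ p w z₀ ≤ dualFun C f h ρ p y₀ z₀) ∧
  (x₀ = z₀ ∨
    (x₀ ∈ ballX d r C ∧ ∀ x ∈ ballX d r C, primalFun f h ρ p x₀ z₀ ≤ primalFun f h ρ p x z₀))

/-- The iteration of sm-MGDA on `min_{x ∈ M} max_y f(x, y) - h(y)`. -/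
structure IsSmMGDA {d r e : ℕ} (C : ℝ) (f : Mat d r → Vec e → ℝ) (h : Vec e → EReal)
    (ρ p : ℝ) (τ₁ : ℕ → ℝ) (τ₂ : ℝ) (θ : ℕ → ℝ) (β : ℝ)
    (x : ℕ → Mat d r) (y : ℕ → Vec e) (z : ℕ → Mat d r) : Prop where
  x_step : ∀ t, IsProj (ballX d r C)
    (x t - τ₁ t • ((gradA (x t) (gradX f (AMap (x t)) (y t))
      + (ρ / 2) • gradC (x t) (cMap (x t))) + p • (x t - z t))) (x (t + 1))
  y_step : ∀ t, IsProx τ₂ h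
    (y t + τ₂ • (gradY f (AMap (x (t + 1))) (y t) - θ t • y t)) (y (t + 1))
  z_step : ∀ t, z (t + 1) = z t + β • (x (t + 1) - z t)

/-- A run of sm-MGDA on `min_{x ∈ M} max_y f(x, y) - h(y)` from an admissible initial point, with
the parameters for the case of modulus `μ` and convex `h`: `τ₁ = s / l`, `θ = 0`,
`τ₂ = 1/16 (3 / τ₁)⁻¹`, `p = 2 l`, `β = α min{μ, l} τ₂`. -/
def IsRun {d r e : ℕ} (C : ℝ) (f : Mat d r → Vec e → ℝ) (h : Vec e → EReal)
    (μ ρ l s α : ℝ) (x : ℕ → Mat d r) (y : ℕ → Vec e) (z : ℕ → Mat d r) : Prop :=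
  IsInit C f h ρ (2 * l) (x 0) (y 0) (z 0) ∧
  IsSmMGDA C f h ρ (2 * l) (fun _ => s / l) (1 / 16 * (3 / (s / l))⁻¹) (fun _ => 0)
    (α * min μ l * (1 / 16 * (3 / (s / l))⁻¹)) x y z

end SmMGDA

end

noncomputable section

namespace SmMGDA

/-! ### Smoothed gradient descent ascent for an abstract saddle point problem -/

section Abstract

variable {E F : Type*} [NormedAddCommGroup E] [InnerProductSpace ℝ E]
  [NormedAddCommGroup F] [InnerProductSpace ℝ F]

open scoped RealInnerProductSpace

/-- The problem `min_{x ∈ X} max_{y ∈ Y} g(x, y) - H(y)` on compact convex sets, where `g` has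
partial gradients `gx`, `gy` that are Lipschitz with constant `l` in each variable, `g(x, ·)` is
strongly concave with modulus `μ`, and `H` is convex. -/
structure IsSaddleProblem (X : Set E) (Y : Set F) (g : E → F → ℝ) (gx : E → F → E)
    (gy : E → F → F) (H : F → ℝ) (l μ : ℝ) : Prop where
  convex_X : Convex ℝ X
  isCompact_X : IsCompact X
  nonempty_X : X.Nonempty
  isCompact_Y : IsCompact Y
  nonempty_Y : Y.Nonempty
  continuousOn_g : ContinuousOn (fun q : E × F => g q.1 q.2) (X ×ˢ Y)
  continuousOn_H : ContinuousOn H Y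
  convexOn_H : ConvexOn ℝ Y H
  l_pos : 0 < l
  μ_pos : 0 < μ
  lipschitz_gx : ∀ x₁ ∈ X, ∀ x₂ ∈ X, ∀ y₁ ∈ Y, ∀ y₂ ∈ Y,
    ‖gx x₁ y₁ - gx x₂ y₂‖ ≤ l * ‖x₁ - x₂‖ + l * ‖y₁ - y₂‖
  lipschitz_gy : ∀ x₁ ∈ X, ∀ x₂ ∈ X, ∀ y₁ ∈ Y, ∀ y₂ ∈ Y,
    ‖gy x₁ y₁ - gy x₂ y₂‖ ≤ l * ‖x₁ - x₂‖ + l * ‖y₁ - y₂‖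
  expand_x : ∀ x₁ ∈ X, ∀ x₂ ∈ X, ∀ y ∈ Y,
    |g x₂ y - g x₁ y - ⟪gx x₁ y, x₂ - x₁⟫| ≤ l / 2 * ‖x₂ - x₁‖ ^ 2
  concave : ∀ x ∈ X, ∀ y ∈ Y, ∀ w ∈ Y,
    g x w ≤ g x y + ⟪gy x y, w - y⟫ - μ / 2 * ‖w - y‖ ^ 2

/-- The proximally smoothed function `g(x, y) + l ‖x - z‖² - H(y)`. -/
def lag (g : E → F → ℝ) (H : F → ℝ) (l : ℝ) (x : E) (y : F) (z : E) : ℝ :=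
  g x y + l * ‖x - z‖ ^ 2 - H y

/-- A minimizer of the smoothed function over `X`. -/
def argX (X : Set E) (g : E → F → ℝ) (H : F → ℝ) (l : ℝ) (y : F) (z : E) : E :=
  Classical.epsilon fun x => x ∈ X ∧ ∀ u ∈ X, lag g H l x y z ≤ lag g H l u y z

/-- The dual function `min_{x ∈ X}` of the smoothed function. -/
def dualVal (X : Set E) (g : E → F → ℝ) (H : F → ℝ) (l : ℝ) (y : F) (z : E) : ℝ :=
  lag g H l (argX X g H l y z) y z

/-- A maximizer of the dual function over `Y`. -/
def argY (X : Set E) (Y : Set F) (g : E → F → ℝ) (H : F → ℝ) (l : ℝ) (z : E) : F :=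
  have : Nonempty F := ⟨0⟩
  Classical.epsilon fun y => y ∈ Y ∧ ∀ w ∈ Y, dualVal X g H l w z ≤ dualVal X g H l y z

/-- The potential function. -/
def potential (X : Set E) (Y : Set F) (g : E → F → ℝ) (H : F → ℝ) (l : ℝ) (x : E) (y : F)
    (z : E) : ℝ :=
  lag g H l x y z - 2 * dualVal X g H l y z + 2 * dualVal X g H l (argY X Y g H l z) z

lemma nonneg_of_forall_small {a c : ℝ} (h : ∀ θ : ℝ, 0 < θ → θ ≤ 1 → 0 ≤ θ * a + θ ^ 2 * c) :
    0 ≤ a := by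
  by_contra! ha
  rcases le_or_gt c 0 with hc | hc
  · have := h 1 one_pos le_rfl
    linarith
  · have hpos : 0 < min 1 (-a / (2 * c)) := lt_min one_pos (by apply div_pos <;> linarith)
    have h1 := h _ hpos (min_le_left _ _)
    have h2 : min 1 (-a / (2 * c)) * c ≤ -a / 2 := by
      calc _ ≤ -a / (2 * c) * c := by gcongr; exact min_le_right _ _
        _ = -a / 2 := by field_simp
    nlinarith

lemma le_of_mul_self_le_mul {a b c : ℝ} (ha : 0 ≤ a) (hb : 0 ≤ b) (h : c * (a * a) ≤ b * a) :
    c * a ≤ b := by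
  rcases ha.eq_or_lt with rfl | ha
  · simpa using hb
  · exact le_of_mul_le_mul_right (by linarith) ha

/-- The variational inequality of a projection onto a convex set. -/
lemma inner_le_zero_of_isProj {X : Set E} (hX : Convex ℝ X) {u p : E} (h : IsProj X u p) :
    ∀ w ∈ X, ⟪u - p, w - p⟫ ≤ 0 := by
  intro w hw
  have key : 0 ≤ -⟪u - p, w - p⟫ := by
    refine nonneg_of_forall_small (c := ‖w - p‖ ^ 2 / 2) fun θ h0 h1 => ?_
    have hm := hX.add_smul_sub_mem h.1 hw ⟨h0.le, h1⟩
    have h2 := h.2 _ hm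
    have h3 : u - (p + θ • (w - p)) = (u - p) - θ • (w - p) := by abel
    rw [h3] at h2
    have h4 : ‖u - p‖ ^ 2 ≤ ‖(u - p) - θ • (w - p)‖ ^ 2 := by gcongr
    rw [norm_sub_sq_real (u - p), inner_smul_right, norm_smul, mul_pow, Real.norm_eq_abs,
      sq_abs] at h4
    linarith
  linarith

namespace IsSaddleProblem

variable {X : Set E} {Y : Set F} {g : E → F → ℝ} {gx : E → F → E} {gy : E → F → F} {H : F → ℝ}
  {l μ : ℝ}

lemma continuousOn_left (P : IsSaddleProblem X Y g gx gy H l μ) {y : F} (hy : y ∈ Y) :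
    ContinuousOn (fun x => g x y) X :=
  P.continuousOn_g.comp (f := fun x => (x, y)) (by fun_prop) fun _ hx => ⟨hx, hy⟩

lemma lag_expand {F : Type*} {g : E → F → ℝ} {gx : E → F → E} {H : F → ℝ} {l : ℝ}
    (x x' : E) (y : F) (z : E) :
    lag g H l x' y z = lag g H l x y z + (g x' y - g x y - ⟪gx x y, x' - x⟫)
      + ⟪gx x y + (2 * l) • (x - z), x' - x⟫ + l * ‖x' - x‖ ^ 2 := by
  have h : x' - z = (x - z) + (x' - x) := by abel
  rw [lag, lag, h, norm_add_sq_real, inner_add_left, inner_smul_left]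
  simp only [conj_trivial]
  ring

lemma lag_le (P : IsSaddleProblem X Y g gx gy H l μ) {x x' : E} {y : F} (hx : x ∈ X)
    (hx' : x' ∈ X) (hy : y ∈ Y) (z : E) :
    lag g H l x' y z ≤ lag g H l x y z + ⟪gx x y + (2 * l) • (x - z), x' - x⟫
      + 3 * l / 2 * ‖x' - x‖ ^ 2 := by
  rw [lag_expand (gx := gx) x x' y z]
  linarith [(abs_le.1 (P.expand_x x hx x' hx' y hy)).2]

lemma le_lag (P : IsSaddleProblem X Y g gx gy H l μ) {x x' : E} {y : F} (hx : x ∈ X)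
    (hx' : x' ∈ X) (hy : y ∈ Y) (z : E) :
    lag g H l x y z + ⟪gx x y + (2 * l) • (x - z), x' - x⟫ + l / 2 * ‖x' - x‖ ^ 2
      ≤ lag g H l x' y z := by
  rw [lag_expand (gx := gx) x x' y z]
  linarith [(abs_le.1 (P.expand_x x hx x' hx' y hy)).1]

lemma argX_spec (P : IsSaddleProblem X Y g gx gy H l μ) {y : F} (hy : y ∈ Y) (z : E) :
    argX X g H l y z ∈ X ∧
      ∀ u ∈ X, lag g H l (argX X g H l y z) y z ≤ lag g H l u y z := by
  have hc : ContinuousOn (fun x => lag g H l x y z) X := by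
    have := P.continuousOn_left hy
    unfold lag
    fun_prop
  obtain ⟨x, hx, hmin⟩ := P.isCompact_X.exists_isMinOn P.nonempty_X hc
  exact Classical.epsilon_spec
    (p := fun x => x ∈ X ∧ ∀ u ∈ X, lag g H l x y z ≤ lag g H l u y z) ⟨x, hx, fun u hu => hmin hu⟩

lemma dualVal_le (P : IsSaddleProblem X Y g gx gy H l μ) {y : F} (hy : y ∈ Y) (z : E) {u : E}
    (hu : u ∈ X) : dualVal X g H l y z ≤ lag g H l u y z :=
  (P.argX_spec hy z).2 u hu

lemma argX_inner_nonneg (P : IsSaddleProblem X Y g gx gy H l μ) {y : F} (hy : y ∈ Y) (z : E)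
    {u : E} (hu : u ∈ X) :
    0 ≤ ⟪gx (argX X g H l y z) y + (2 * l) • (argX X g H l y z - z), u - argX X g H l y z⟫ := by
  obtain ⟨hx, hmin⟩ := P.argX_spec hy z
  set x := argX X g H l y z
  refine nonneg_of_forall_small (c := 3 * l / 2 * ‖u - x‖ ^ 2) fun θ h0 h1 => ?_
  have hm := P.convex_X.add_smul_sub_mem hx hu ⟨h0.le, h1⟩
  have h2 := P.lag_le hx hm hy z
  have h3 := hmin _ hm
  rw [add_sub_cancel_left, inner_smul_right, norm_smul, mul_pow, Real.norm_eq_abs, sq_abs] at h2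
  linarith

lemma argX_growth (P : IsSaddleProblem X Y g gx gy H l μ) {y : F} (hy : y ∈ Y) (z : E) {u : E}
    (hu : u ∈ X) :
    dualVal X g H l y z + l / 2 * ‖u - argX X g H l y z‖ ^ 2 ≤ lag g H l u y z := by
  have h1 := P.le_lag (P.argX_spec hy z).1 hu hy z
  have h2 := P.argX_inner_nonneg hy z hu
  unfold dualVal
  linarith

/-- The error bound for the primal step. -/
lemma argX_error (P : IsSaddleProblem X Y g gx gy H l μ) {y : F} (hy : y ∈ Y) (z : E)
    {x x' v : E} {c : ℝ} (hx : x ∈ X) (hx' : x' ∈ X)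
    (hv : ∀ u ∈ X, 0 ≤ ⟪gx x y + (2 * l) • (x - z) + v, u - x'⟫) (hc : ‖v‖ ≤ c * ‖x' - x‖) :
    l * ‖x' - argX X g H l y z‖ ≤ (c + 3 * l) * ‖x' - x‖ := by
  have hs := (P.argX_spec hy z).1
  have h1 := P.argX_inner_nonneg hy z hx'
  set w := argX X g H l y z
  have h2 := hv w hs
  have hl := P.l_pos
  have e1 : (gx x y + (2 * l) • (x - z) + v) =
      (gx w y + (2 * l) • (w - z)) + (gx x y - gx x' y) + (gx x' y - gx w y) + v
        + (2 * l) • (x' - w) - (2 * l) • (x' - x) := by module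
  have e2 : w - x' = -(x' - w) := by abel
  rw [e1, e2, inner_neg_right, inner_sub_left, inner_add_left, inner_add_left, inner_add_left,
    inner_add_left, inner_smul_left, inner_smul_left, real_inner_self_eq_norm_sq] at h2
  simp only [conj_trivial] at h2
  have b1 : |⟪gx x y - gx x' y, x' - w⟫| ≤ (l * ‖x' - x‖) * ‖x' - w‖ := by
    refine (abs_real_inner_le_norm _ _).trans ?_
    gcongr
    have := P.lipschitz_gx x hx x' hx' y hy y hy
    simpa [norm_sub_rev x x'] using this
  have b2 : |⟪gx x' y - gx w y, x' - w⟫| ≤ (l * ‖x' - w‖) * ‖x' - w‖ := by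
    refine (abs_real_inner_le_norm _ _).trans ?_
    gcongr
    simpa using P.lipschitz_gx x' hx' w hs y hy y hy
  have b3 : |⟪v, x' - w⟫| ≤ (c * ‖x' - x‖) * ‖x' - w‖ := by
    refine (abs_real_inner_le_norm _ _).trans ?_
    gcongr
  have b4 : |⟪x' - x, x' - w⟫| ≤ ‖x' - x‖ * ‖x' - w‖ := abs_real_inner_le_norm _ _
  have b4' := mul_le_mul_of_nonneg_left (abs_le.1 b4).2 (by linarith : 0 ≤ 2 * l)
  refine le_of_mul_self_le_mul (norm_nonneg _) ?_ ?_
  · have : 0 ≤ c * ‖x' - x‖ := (norm_nonneg _).trans hc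
    nlinarith [norm_nonneg (x' - x)]
  · nlinarith [(abs_le.1 b1).1, (abs_le.1 b2).1, (abs_le.1 b3).1]

lemma argX_lipschitz (P : IsSaddleProblem X Y g gx gy H l μ) {y₁ y₂ : F} (h₁ : y₁ ∈ Y)
    (h₂ : y₂ ∈ Y) (z₁ z₂ : E) :
    ‖argX X g H l y₁ z₁ - argX X g H l y₂ z₂‖ ≤ ‖y₁ - y₂‖ + 2 * ‖z₁ - z₂‖ := by
  have hs₁ := (P.argX_spec h₁ z₁).1
  have hs₂ := (P.argX_spec h₂ z₂).1
  have e₁ := P.argX_inner_nonneg h₁ z₁ hs₂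
  have e₂ := P.argX_inner_nonneg h₂ z₂ hs₁
  set x₁ := argX X g H l y₁ z₁
  set x₂ := argX X g H l y₂ z₂
  have hl := P.l_pos
  have b1 : |⟪gx x₁ y₁ - gx x₂ y₂, x₁ - x₂⟫| ≤ (l * ‖x₁ - x₂‖ + l * ‖y₁ - y₂‖) * ‖x₁ - x₂‖ := by
    refine (abs_real_inner_le_norm _ _).trans ?_
    gcongr
    exact P.lipschitz_gx x₁ hs₁ x₂ hs₂ y₁ h₁ y₂ h₂
  have b2 : ⟪z₁ - z₂, x₁ - x₂⟫ ≤ ‖z₁ - z₂‖ * ‖x₁ - x₂‖ := real_inner_le_norm _ _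
  have b2' := mul_le_mul_of_nonneg_left b2 (by linarith : 0 ≤ 2 * l)
  have e3 : gx x₁ y₁ + (2 * l) • (x₁ - z₁) = (gx x₂ y₂ + (2 * l) • (x₂ - z₂))
      + (gx x₁ y₁ - gx x₂ y₂) + (2 * l) • (x₁ - x₂) - (2 * l) • (z₁ - z₂) := by module
  rw [← neg_sub x₁ x₂, inner_neg_right, e3, inner_sub_left, inner_add_left, inner_add_left,
    inner_smul_left, inner_smul_left, real_inner_self_eq_norm_sq] at e₁
  simp only [conj_trivial] at e₁
  have : l * ‖x₁ - x₂‖ ≤ l * (‖y₁ - y₂‖ + 2 * ‖z₁ - z₂‖) := by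
    refine le_of_mul_self_le_mul (norm_nonneg _) (by positivity) ?_
    nlinarith [(abs_le.1 b1).1]
  exact le_of_mul_le_mul_left this hl

lemma continuousOn_argX (P : IsSaddleProblem X Y g gx gy H l μ) (z : E) :
    ContinuousOn (fun y => argX X g H l y z) Y := by
  have : LipschitzOnWith 1 (fun y => argX X g H l y z) Y := by
    refine LipschitzOnWith.of_dist_le_mul fun y hy w hw => ?_
    simpa [dist_eq_norm] using P.argX_lipschitz hy hw z z
  exact this.continuousOn

lemma continuousOn_dualVal (P : IsSaddleProblem X Y g gx gy H l μ) (z : E) :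
    ContinuousOn (fun y => dualVal X g H l y z) Y := by
  have h1 := P.continuousOn_argX z
  have h2 : ContinuousOn (fun y => g (argX X g H l y z) y) Y :=
    P.continuousOn_g.comp (f := fun y => (argX X g H l y z, y)) (h1.prodMk continuousOn_id)
      fun y hy => ⟨(P.argX_spec hy z).1, hy⟩
  exact (h2.add (((h1.sub continuousOn_const).norm.pow 2).const_mul l)).sub P.continuousOn_H

lemma argY_spec (P : IsSaddleProblem X Y g gx gy H l μ) (z : E) :
    argY X Y g H l z ∈ Y ∧
      ∀ w ∈ Y, dualVal X g H l w z ≤ dualVal X g H l (argY X Y g H l z) z := by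
  obtain ⟨y, hy, hmax⟩ := P.isCompact_Y.exists_isMaxOn P.nonempty_Y (P.continuousOn_dualVal z)
  exact Classical.epsilon_spec
    (p := fun y => y ∈ Y ∧ ∀ w ∈ Y, dualVal X g H l w z ≤ dualVal X g H l y z)
    ⟨y, hy, fun w hw => hmax hw⟩

/-- Strong concavity of the smoothed function along segments. -/
lemma lag_concave (P : IsSaddleProblem X Y g gx gy H l μ) {x : E} (hx : x ∈ X) {y w : F}
    (hy : y ∈ Y) (hw : w ∈ Y) (z : E) {θ : ℝ} (h0 : 0 ≤ θ) (h1 : θ ≤ 1) :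
    lag g H l x y z + θ * (lag g H l x w z - lag g H l x y z)
      + μ / 2 * θ * (1 - θ) * ‖w - y‖ ^ 2 ≤ lag g H l x (y + θ • (w - y)) z := by
  have hm := P.convexOn_H.1.add_smul_sub_mem hy hw ⟨h0, h1⟩
  have c1 := P.concave x hx _ hm y hy
  have c2 := P.concave x hx _ hm w hw
  have e1 : y - (y + θ • (w - y)) = (-θ) • (w - y) := by module
  have e2 : w - (y + θ • (w - y)) = (1 - θ) • (w - y) := by module
  rw [e1, inner_smul_right, norm_smul, mul_pow, Real.norm_eq_abs, sq_abs] at c1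
  rw [e2, inner_smul_right, norm_smul, mul_pow, Real.norm_eq_abs, sq_abs] at c2
  have c3 := P.convexOn_H.2 hy hw (by linarith : 0 ≤ 1 - θ) h0 (by ring)
  have e3 : (1 - θ) • y + θ • w = y + θ • (w - y) := by module
  rw [e3] at c3
  simp only [smul_eq_mul] at c3
  have d1 := mul_le_mul_of_nonneg_left c1 (by linarith : 0 ≤ 1 - θ)
  have d2 := mul_le_mul_of_nonneg_left c2 h0
  unfold lag
  nlinarith

/-- The maximizer of the dual function maximizes the smoothed function at its minimizer. -/
lemma saddle (P : IsSaddleProblem X Y g gx gy H l μ) (z : E) {w : F} (hw : w ∈ Y) :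
    lag g H l (argX X g H l (argY X Y g H l z) z) w z
      ≤ dualVal X g H l (argY X Y g H l z) z := by
  obtain ⟨hy, hmax⟩ := P.argY_spec z
  set y := argY X Y g H l z
  have key : ∀ θ : ℝ, 0 < θ → θ ≤ 1 →
      lag g H l (argX X g H l (y + θ • (w - y)) z) w z ≤ dualVal X g H l y z := by
    intro θ h0 h1
    have hm := P.convexOn_H.1.add_smul_sub_mem hy hw ⟨h0.le, h1⟩
    have hx := (P.argX_spec hm z).1
    have c1 := P.lag_concave hx hy hw z h0.le h1
    have c2 := hmax _ hm
    have c3 := P.dualVal_le hy z hx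
    have c4 : 0 ≤ μ / 2 * θ * (1 - θ) * ‖w - y‖ ^ 2 := by
      have := P.μ_pos
      have : 0 ≤ 1 - θ := by linarith
      positivity
    rw [show dualVal X g H l (y + θ • (w - y)) z = lag g H l (argX X g H l (y + θ • (w - y)) z)
      (y + θ • (w - y)) z from rfl] at c2
    by_contra! hlt
    nlinarith [mul_pos h0 (sub_pos.2 hlt), mul_nonneg (sub_nonneg.2 h1) (sub_nonneg.2 c3)]
  have hseg : Filter.Tendsto (fun θ : ℝ => y + θ • (w - y)) (nhdsWithin 0 (Set.Ioc 0 1))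
      (nhdsWithin y Y) := by
    refine tendsto_nhdsWithin_iff.2 ⟨?_, ?_⟩
    · have : Continuous fun θ : ℝ => y + θ • (w - y) := by fun_prop
      simpa using (this.tendsto 0).mono_left nhdsWithin_le_nhds
    · filter_upwards [self_mem_nhdsWithin] with θ hθ
      exact P.convexOn_H.1.add_smul_sub_mem hy hw ⟨hθ.1.le, hθ.2⟩
  have hcont : ContinuousOn (fun v => lag g H l (argX X g H l v z) w z) Y := by
    have h1 := P.continuousOn_argX z
    have h2 : ContinuousOn (fun v => g (argX X g H l v z) w) Y :=
      (P.continuousOn_left hw).comp h1 fun v hv => (P.argX_spec hv z).1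
    exact (h2.add (((h1.sub continuousOn_const).norm.pow 2).const_mul l)).sub continuousOn_const
  have hlim := (hcont y hy).tendsto.comp hseg
  have hne : (nhdsWithin (0 : ℝ) (Set.Ioc 0 1)).NeBot :=
    mem_closure_iff_nhdsWithin_neBot.1 (by rw [closure_Ioc (by norm_num)]; simp)
  refine le_of_tendsto hlim ?_
  filter_upwards [self_mem_nhdsWithin] with θ hθ
  exact key θ hθ.1 hθ.2

/-- Quadratic growth at the maximizer. -/
lemma saddle_growth (P : IsSaddleProblem X Y g gx gy H l μ) (z : E) {w : F} (hw : w ∈ Y) :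
    lag g H l (argX X g H l (argY X Y g H l z) z) w z + μ / 2 * ‖w - argY X Y g H l z‖ ^ 2
      ≤ dualVal X g H l (argY X Y g H l z) z := by
  have hy := (P.argY_spec z).1
  have hx := (P.argX_spec hy z).1
  have hs := fun v => P.saddle z (w := v)
  set y := argY X Y g H l z
  set x := argX X g H l y z
  have key : 0 ≤ dualVal X g H l y z - lag g H l x w z - μ / 2 * ‖w - y‖ ^ 2 := by
    refine nonneg_of_forall_small (c := μ / 2 * ‖w - y‖ ^ 2) fun θ h0 h1 => ?_
    have c1 := P.lag_concave hx hy hw z h0.le h1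
    have c2 := hs _ (P.convexOn_H.1.add_smul_sub_mem hy hw ⟨h0.le, h1⟩)
    rw [show dualVal X g H l y z = lag g H l x y z from rfl] at c2 ⊢
    linarith
  linarith

end IsSaddleProblem

end Abstract

section Descent

variable {E F : Type*} [NormedAddCommGroup E] [InnerProductSpace ℝ E]
  [NormedAddCommGroup F] [InnerProductSpace ℝ F]

open scoped RealInnerProductSpace

namespace IsSaddleProblem

variable {X : Set E} {Y : Set F} {g : E → F → ℝ} {gx : E → F → E} {gy : E → F → F} {H : F → ℝ}
  {l μ : ℝ}

/-- Descent of the smoothed function in the primal step. -/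
lemma primal_descent (P : IsSaddleProblem X Y g gx gy H l μ) {κ : ℝ} (hκ : 3 * l ≤ κ)
    {x x' z : E} {y : F} (hx : x ∈ X) (hx' : x' ∈ X) (hy : y ∈ Y)
    (hxs : ∀ u ∈ X, 0 ≤ ⟪gx x y + (2 * l) • (x - z) + κ • (x' - x), u - x'⟫) :
    lag g H l x' y z ≤ lag g H l x y z - κ / 2 * ‖x' - x‖ ^ 2 := by
  have h1 := P.lag_le hx hx' hy z
  have h2 := hxs x hx
  rw [← neg_sub x' x, inner_neg_right, inner_add_left, inner_smul_left,
    real_inner_self_eq_norm_sq] at h2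
  simp only [conj_trivial] at h2
  nlinarith [sq_nonneg ‖x' - x‖]

lemma primal_error (P : IsSaddleProblem X Y g gx gy H l μ) {κ : ℝ} (hκ : 3 * l ≤ κ)
    {x x' z : E} {y : F} (hx : x ∈ X) (hx' : x' ∈ X) (hy : y ∈ Y)
    (hxs : ∀ u ∈ X, 0 ≤ ⟪gx x y + (2 * l) • (x - z) + κ • (x' - x), u - x'⟫) :
    l * ‖x' - argX X g H l y z‖ ≤ 2 * κ * ‖x' - x‖ := by
  have hl := P.l_pos
  have h := P.argX_error hy z (c := κ) hx hx' hxs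
    (by rw [norm_smul, Real.norm_of_nonneg (by linarith)])
  nlinarith [norm_nonneg (x' - x)]

/-- The dual step does not increase the smoothed function by more than the first-order gain. -/
lemma dual_step_le (P : IsSaddleProblem X Y g gx gy H l μ) {x z : E} {y y' : F}
    (hx : x ∈ X) (hy : y ∈ Y) (hy' : y' ∈ Y) :
    lag g H l x y' z ≤ lag g H l x y z + (⟪gy x y, y' - y⟫ + H y - H y') := by
  have h1 := P.concave x hx y hy y' hy'
  have := P.μ_pos
  have : 0 ≤ μ / 2 * ‖y' - y‖ ^ 2 := by positivity
  unfold lag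
  linarith

/-- Ascent of the dual function in the dual step. -/
lemma dual_ascent (P : IsSaddleProblem X Y g gx gy H l μ) {κ : ℝ} (hκ : 3 * l ≤ κ)
    {x x' z : E} {y y' : F} (hx : x ∈ X) (hx' : x' ∈ X) (hy : y ∈ Y) (hy' : y' ∈ Y)
    (hxs : ∀ u ∈ X, 0 ≤ ⟪gx x y + (2 * l) • (x - z) + κ • (x' - x), u - x'⟫) :
    dualVal X g H l y z + (⟪gy x' y, y' - y⟫ + H y - H y')
        - 2 * l * ‖y' - y‖ ^ 2 - 2 * κ * ‖x' - x‖ * ‖y' - y‖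
      ≤ dualVal X g H l y' z := by
  have hl := P.l_pos
  have hs := (P.argX_spec hy' z).1
  have h1 := P.dualVal_le hy z hs
  have h2 := P.primal_error hκ hx hx' hy hxs
  have h3 := P.argX_lipschitz hy hy' z z
  rw [sub_self, norm_zero, mul_zero, add_zero, norm_sub_rev y y'] at h3
  rw [show dualVal X g H l y' z = lag g H l (argX X g H l y' z) y' z from rfl]
  set w := argX X g H l y' z
  have h4 := P.concave w hs y' hy' y hy
  have h5 : |⟪gy x' y - gy w y', y' - y⟫| ≤ (l * ‖x' - w‖ + l * ‖y' - y‖) * ‖y' - y‖ := by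
    refine (abs_real_inner_le_norm _ _).trans ?_
    gcongr
    rw [norm_sub_rev y' y]
    exact P.lipschitz_gy x' hx' w hs y hy y' hy'
  have h6 : l * ‖x' - w‖ ≤ 2 * κ * ‖x' - x‖ + l * ‖y' - y‖ := by
    have := norm_sub_le_norm_sub_add_norm_sub x' (argX X g H l y z) w
    nlinarith
  have h7 : (l * ‖x' - w‖) * ‖y' - y‖ ≤ (2 * κ * ‖x' - x‖ + l * ‖y' - y‖) * ‖y' - y‖ := by
    gcongr
  rw [← neg_sub y' y, inner_neg_right] at h4
  rw [inner_sub_left] at h5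
  have := P.μ_pos
  have : 0 ≤ μ / 2 * ‖-(y' - y)‖ ^ 2 := by positivity
  unfold lag at h1 ⊢
  nlinarith [(abs_le.1 h5).2]

/-- The error bound for the dual step. -/
lemma dual_error (P : IsSaddleProblem X Y g gx gy H l μ) {κ : ℝ} (hκ : 3 * l ≤ κ)
    {x x' z : E} {y y' : F} (hx : x ∈ X) (hx' : x' ∈ X) (hy : y ∈ Y) (hy' : y' ∈ Y)
    (hxs : ∀ u ∈ X, 0 ≤ ⟪gx x y + (2 * l) • (x - z) + κ • (x' - x), u - x'⟫)
    (hys : ∀ w ∈ Y, H y' + ⟪gy x' y - (48 * κ) • (y' - y), w - y'⟫ ≤ H w) :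
    4 * l * μ * ‖argX X g H l y' z - argX X g H l (argY X Y g H l z) z‖ ^ 2
      ≤ (49 * κ * ‖y' - y‖ + 2 * κ * ‖x' - x‖) ^ 2 := by
  have hl := P.l_pos
  have hμ := P.μ_pos
  have hs := (P.argX_spec hy' z).1
  have hv := (P.argY_spec z).1
  have hs₂ := (P.argX_spec hv z).1
  have g1 := P.argX_growth hy' z hs₂
  have g2 := P.saddle_growth z hy'
  have g3 := P.argX_growth hv z hs
  have h2 := P.primal_error hκ hx hx' hy hxs
  have h3 := P.argX_lipschitz hy hy' z z
  rw [sub_self, norm_zero, mul_zero, add_zero, norm_sub_rev y y'] at h3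
  rw [show dualVal X g H l y' z = lag g H l (argX X g H l y' z) y' z from rfl] at g1
  set v := argY X Y g H l z
  set x₁ := argX X g H l y' z
  set x₂ := argX X g H l v z
  have h4 := P.concave x₁ hs y' hy' v hv
  have h5 := hys v hv
  have hR : ⟪gy x₁ y' - (gy x' y - (48 * κ) • (y' - y)), v - y'⟫
      ≤ (49 * κ * ‖y' - y‖ + 2 * κ * ‖x' - x‖) * ‖v - y'‖ := by
    refine (real_inner_le_norm _ _).trans ?_
    gcongr
    have e : gy x₁ y' - (gy x' y - (48 * κ) • (y' - y))
        = (gy x₁ y' - gy x' y) + (48 * κ) • (y' - y) := by abel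
    rw [e]
    refine (norm_add_le _ _).trans ?_
    rw [norm_smul, Real.norm_of_nonneg (by linarith)]
    have h6 := P.lipschitz_gy x₁ hs x' hx' y' hy' y hy
    have h7 := norm_sub_le_norm_sub_add_norm_sub x' (argX X g H l y z) x₁
    rw [norm_sub_rev x₁ x'] at h6
    nlinarith [norm_nonneg (y' - y)]
  set R := 49 * κ * ‖y' - y‖ + 2 * κ * ‖x' - x‖
  rw [inner_sub_left] at hR
  rw [norm_sub_rev x₂ x₁] at g1
  rw [norm_sub_rev y' v] at g2
  unfold lag at g1 g2 g3
  have key : l * ‖x₁ - x₂‖ ^ 2 + μ * ‖v - y'‖ ^ 2 ≤ R * ‖v - y'‖ := by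
    unfold dualVal lag at g2 g3
    linarith
  nlinarith [sq_nonneg (R - 2 * μ * ‖v - y'‖)]

/-- The effect of the proximal center on the dual part of the potential. -/
lemma center_step_le (P : IsSaddleProblem X Y g gx gy H l μ) {y : F} (hy : y ∈ Y) (z z' : E) :
    2 * (dualVal X g H l (argY X Y g H l z') z' - dualVal X g H l (argY X Y g H l z) z)
        - 2 * (dualVal X g H l y z' - dualVal X g H l y z)
      ≤ 4 * l * ‖z' - z‖ *
        (2 * ‖z' - z‖ + ‖argX X g H l y z - argX X g H l (argY X Y g H l z) z‖) := by
  have hl := P.l_pos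
  have hv := (P.argY_spec z).1
  have hv' := (P.argY_spec z').1
  have hs₂ := (P.argX_spec hv z).1
  have hs₃ := (P.argX_spec hy z').1
  have a1 := P.dualVal_le hv' z' hs₂
  have a2 := P.saddle z hv'
  have a3 := P.dualVal_le hy z hs₃
  have a4 := P.argX_lipschitz hy hy z' z
  rw [sub_self, norm_zero, zero_add] at a4
  rw [show dualVal X g H l y z' = lag g H l (argX X g H l y z') y z' from rfl]
  set v := argY X Y g H l z
  set v' := argY X Y g H l z'
  set x₁ := argX X g H l y z
  set x₂ := argX X g H l v z
  set x₃ := argX X g H l y z'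
  have e : ∀ u : E, ‖u - z'‖ ^ 2 = ‖u - z‖ ^ 2 - 2 * ⟪u - z, z' - z⟫ + ‖z' - z‖ ^ 2 := by
    intro u
    rw [← norm_sub_sq_real]
    congr 2
    abel
  have e2 := e x₂
  have e3 := e x₃
  have e4 : ⟪x₃ - z, z' - z⟫ - ⟪x₂ - z, z' - z⟫ ≤ ‖x₃ - x₂‖ * ‖z' - z‖ := by
    rw [← inner_sub_left, sub_sub_sub_cancel_right]
    exact real_inner_le_norm _ _
  have e5 : ‖x₃ - x₂‖ ≤ 2 * ‖z' - z‖ + ‖x₁ - x₂‖ :=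
    (norm_sub_le_norm_sub_add_norm_sub _ x₁ _).trans (by linarith)
  have e6 : ‖x₃ - x₂‖ * ‖z' - z‖ ≤ (2 * ‖z' - z‖ + ‖x₁ - x₂‖) * ‖z' - z‖ := by gcongr
  unfold lag at a1 a2 a3 ⊢
  rw [e2] at a1
  rw [e3]
  nlinarith

/-- Sufficient decrease of the potential along one iteration. -/
theorem potential_descent (P : IsSaddleProblem X Y g gx gy H l μ) {κ α β : ℝ}
    (hκ : 3 * l ≤ κ) (hμl : μ ≤ l) (hα0 : 0 < α) (hα : α < 1 / 2306)
    (hβ : β = α * μ / (48 * κ)) {x x' z z' : E} {y y' : F} (hx : x ∈ X) (hx' : x' ∈ X)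
    (hy : y ∈ Y) (hy' : y' ∈ Y)
    (hxs : ∀ u ∈ X, 0 ≤ ⟪gx x y + (2 * l) • (x - z) + κ • (x' - x), u - x'⟫)
    (hys : ∀ w ∈ Y, H y' + ⟪gy x' y - (48 * κ) • (y' - y), w - y'⟫ ≤ H w)
    (hz : z' = z + β • (x' - z)) :
    potential X Y g H l x' y' z' + κ / 8 * ‖x' - x‖ ^ 2 + κ * ‖y' - y‖ ^ 2
        + l * β / 2 * ‖x' - z‖ ^ 2
      ≤ potential X Y g H l x y z := by
  have hl := P.l_pos
  have hμ := P.μ_pos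
  have hκ0 : 0 < κ := by linarith
  have hβ0 : 0 < β := by rw [hβ]; positivity
  have hβ1 : β ≤ 1 / 18 := by
    rw [hβ, div_le_iff₀ (by positivity)]
    nlinarith
  have s1 := P.primal_descent hκ hx hx' hy hxs
  have s2 := P.dual_step_le (z := z) hx' hy hy'
  have s3 := P.dual_ascent hκ hx hx' hy hy' hxs
  have s4 := P.dual_error hκ hx hx' hy hy' hxs hys
  have s5 := P.center_step_le hy' z z'
  have s6 := hys y hy
  have ez : ‖z' - z‖ = β * ‖x' - z‖ := by
    rw [hz, add_sub_cancel_left, norm_smul, Real.norm_of_nonneg hβ0.le]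
  have s7 : lag g H l x' y' z' = lag g H l x' y' z - l * (2 * β - β ^ 2) * ‖x' - z‖ ^ 2 := by
    have : x' - z' = (1 - β) • (x' - z) := by rw [hz]; module
    unfold lag
    rw [this, norm_smul, mul_pow, Real.norm_eq_abs, sq_abs]
    ring
  rw [ez] at s5
  rw [← neg_sub y' y, inner_neg_right, inner_sub_left, inner_smul_left,
    real_inner_self_eq_norm_sq] at s6
  simp only [conj_trivial] at s6
  have hdx := norm_nonneg (x' - x)
  have hdy := norm_nonneg (y' - y)
  have hd := norm_nonneg (x' - z)
  unfold potential
  rw [s7]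
  set a := ‖argX X g H l y' z - argX X g H l (argY X Y g H l z) z‖
  set dx := ‖x' - x‖
  set dy := ‖y' - y‖
  set d := ‖x' - z‖
  have t1 : 4 * l * β * a ^ 2 ≤ κ * (dx ^ 2 / 16 + dy ^ 2) := by
    have e : 4 * l * β * a ^ 2 = α / (48 * κ) * (4 * l * μ * a ^ 2) := by
      rw [hβ]
      ring
    rw [e]
    calc α / (48 * κ) * (4 * l * μ * a ^ 2)
        ≤ α / (48 * κ) * (49 * κ * dy + 2 * κ * dx) ^ 2 := by gcongr
      _ ≤ α / (48 * κ) * (κ ^ 2 * (4802 * dy ^ 2 + 8 * dx ^ 2)) := by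
        gcongr
        linear_combination mul_nonneg (sq_nonneg κ) (sq_nonneg (49 * dy - 2 * dx))
      _ = κ * (α * (4802 * dy ^ 2 + 8 * dx ^ 2) / 48) := by field_simp
      _ ≤ κ * (dx ^ 2 / 16 + dy ^ 2) := by
        gcongr
        nlinarith only [sq_nonneg dx, sq_nonneg dy, hα]
  have t2 : 4 * κ * dx * dy ≤ κ / 4 * dx ^ 2 + 16 * κ * dy ^ 2 := by
    linear_combination (1 / 4) * mul_nonneg hκ0.le (sq_nonneg (dx - 8 * dy))
  have t3 : 4 * l * (β * d) * a ≤ l * β * d ^ 2 + 4 * l * β * a ^ 2 := by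
    linear_combination mul_nonneg (mul_pos hl hβ0).le (sq_nonneg (d - 2 * a))
  have t4 : l * β * (9 * β) * d ^ 2 ≤ l * β * (1 / 2) * d ^ 2 := by
    gcongr
    linarith
  have t5 : l * dy ^ 2 ≤ κ / 3 * dy ^ 2 := by
    gcongr
    linarith
  have t6 : 0 ≤ κ * dx ^ 2 := by positivity
  have t7 : 0 ≤ κ * dy ^ 2 := by positivity
  linarith only [s1, s2, s3, s5, s6, t1, t2, t3, t4, t5, t6, t7]

/-- The smoothed function is bounded by the potential. -/
lemma lag_le_potential (P : IsSaddleProblem X Y g gx gy H l μ) (x : E) {y : F} (hy : y ∈ Y)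
    (z : E) : lag g H l x y z ≤ potential X Y g H l x y z := by
  have := (P.argY_spec z).2 y hy
  unfold potential
  linarith

/-- A lower bound of the smoothed function is a lower bound of the potential. -/
lemma le_potential (P : IsSaddleProblem X Y g gx gy H l μ) {x z : E} {y : F} {m : ℝ}
    (hx : x ∈ X) (hy : y ∈ Y) (hm : ∀ x ∈ X, ∀ y ∈ Y, m ≤ lag g H l x y z) :
    m ≤ potential X Y g H l x y z := by
  have h1 := (P.argY_spec z).2 y hy
  have h2 := P.dualVal_le hy z hx
  have h3 := hm _ (P.argX_spec (P.argY_spec z).1 z).1 _ (P.argY_spec z).1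
  unfold potential
  unfold dualVal at h1 h2 ⊢
  linarith

end IsSaddleProblem

end Descent

/-! ### Matrix calculus -/

section Matrices

open scoped RealInnerProductSpace Matrix

variable {d r k m n : ℕ}

@[simp] lemma toM_ofM (M : Matrix (Fin m) (Fin n) ℝ) : toM (ofM M) = M := rfl

@[simp] lemma ofM_toM (x : Mat m n) : ofM (toM x) = x := rfl

lemma toM_injective : Function.Injective (toM : Mat m n → Matrix (Fin m) (Fin n) ℝ) :=
  Function.LeftInverse.injective ofM_toM

@[simp] lemma toM_add (x y : Mat m n) : toM (x + y) = toM x + toM y := rfl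

@[simp] lemma toM_sub (x y : Mat m n) : toM (x - y) = toM x - toM y := rfl

@[simp] lemma toM_smul (t : ℝ) (x : Mat m n) : toM (t • x) = t • toM x := rfl

lemma ofM_add (M N : Matrix (Fin m) (Fin n) ℝ) : ofM (M + N) = ofM M + ofM N := rfl

lemma ofM_sub (M N : Matrix (Fin m) (Fin n) ℝ) : ofM (M - N) = ofM M - ofM N := rfl

lemma ofM_smul (t : ℝ) (M : Matrix (Fin m) (Fin n) ℝ) : ofM (t • M) = t • ofM M := rfl

lemma inner_eq_trace (x y : Mat m n) : ⟪x, y⟫ = ((toM x)ᵀ * toM y).trace := by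
  rw [PiLp.inner_apply, Fintype.sum_prod_type_right, Matrix.trace]
  refine Finset.sum_congr rfl fun j _ => ?_
  rw [Matrix.diag_apply, Matrix.mul_apply]
  refine Finset.sum_congr rfl fun i _ => ?_
  simp [toM, mul_comm]

lemma norm_sq_eq_trace (x : Mat m n) : ‖x‖ ^ 2 = ((toM x)ᵀ * toM x).trace := by
  rw [← inner_eq_trace, real_inner_self_eq_norm_sq]

lemma norm_ofM_transpose (M : Matrix (Fin m) (Fin n) ℝ) : ‖ofM Mᵀ‖ = ‖ofM M‖ := by
  rw [← sq_eq_sq₀ (norm_nonneg _) (norm_nonneg _), norm_sq_eq_trace, norm_sq_eq_trace, toM_ofM,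
    toM_ofM, Matrix.transpose_transpose, Matrix.trace_mul_comm]

section Frobenius

open scoped Matrix.Norms.Frobenius

lemma norm_ofM (M : Matrix (Fin m) (Fin n) ℝ) : ‖ofM M‖ = ‖M‖ := by
  rw [Matrix.frobenius_norm_def, EuclideanSpace.norm_eq, Real.sqrt_eq_rpow,
    Fintype.sum_prod_type]
  simp [ofM]

lemma norm_ofM_mul_le (M : Matrix (Fin m) (Fin n) ℝ) (N : Matrix (Fin n) (Fin k) ℝ) :
    ‖ofM (M * N)‖ ≤ ‖ofM M‖ * ‖ofM N‖ := by
  simpa only [norm_ofM] using Matrix.frobenius_norm_mul M N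

lemma isUnit_one_add_of_norm_lt {M : Matrix (Fin n) (Fin n) ℝ} (h : ‖ofM M‖ < 1) :
    IsUnit (1 + M) := by
  rw [norm_ofM, ← norm_neg] at h
  simpa using isUnit_one_sub_of_norm_lt_one h

end Frobenius

lemma norm_symPart_le (B : Matrix (Fin n) (Fin n) ℝ) : ‖ofM (symPart B)‖ ≤ ‖ofM B‖ := by
  have h : ofM (symPart B) = (1 / 2 : ℝ) • (ofM B + ofM Bᵀ) := rfl
  rw [h, norm_smul]
  have := norm_add_le (ofM B) (ofM Bᵀ)
  rw [norm_ofM_transpose] at this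
  norm_num
  linarith

lemma transpose_symPart (B : Matrix (Fin n) (Fin n) ℝ) : (symPart B)ᵀ = symPart B := by
  simp [symPart, add_comm]

/-- A map into matrices is smooth if its entries are. -/
lemma contDiff_ofM {E : Type*} [NormedAddCommGroup E] [NormedSpace ℝ E] {N : WithTop ℕ∞}
    {φ : E → Matrix (Fin m) (Fin n) ℝ} (h : ∀ i j, ContDiff ℝ N fun q => φ q i j) :
    ContDiff ℝ N fun q => ofM (φ q) :=
  contDiff_euclidean.2 fun ij => h ij.1 ij.2

lemma contDiff_entry {E : Type*} [NormedAddCommGroup E] [NormedSpace ℝ E] {N : WithTop ℕ∞}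
    {φ : E → Mat m n} (h : ContDiff ℝ N φ) (i : Fin m) (j : Fin n) :
    ContDiff ℝ N fun q => toM (φ q) i j :=
  contDiff_euclidean.1 h (i, j)

lemma contDiff_AMap {N : WithTop ℕ∞} : ContDiff ℝ N (AMap : Mat d r → Mat d r) := by
  refine contDiff_ofM fun i j => ?_
  have h := fun i j => contDiff_entry (N := N) (contDiff_id (𝕜 := ℝ) (E := Mat d r)) i j
  simp only [id] at h
  simp only [Matrix.mul_apply, Matrix.sub_apply, Matrix.smul_apply, Matrix.transpose_apply,
    smul_eq_mul]
  fun_prop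

lemma contDiff_cMap {N : WithTop ℕ∞} : ContDiff ℝ N (cMap : Mat d r → Mat r r) := by
  refine contDiff_ofM fun i j => ?_
  have h := fun i j => contDiff_entry (N := N) (contDiff_id (𝕜 := ℝ) (E := Mat d r)) i j
  simp only [id] at h
  simp only [Matrix.mul_apply, Matrix.sub_apply, Matrix.transpose_apply]
  fun_prop

lemma contDiff_gradA {N : WithTop ℕ∞} :
    ContDiff ℝ N fun q : Mat d r × Mat d r => gradA q.1 q.2 := by
  refine contDiff_ofM fun i j => ?_
  have h := fun i j =>
    contDiff_entry (N := N) (contDiff_fst (𝕜 := ℝ) (E := Mat d r) (F := Mat d r)) i j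
  have h' := fun i j =>
    contDiff_entry (N := N) (contDiff_snd (𝕜 := ℝ) (E := Mat d r) (F := Mat d r)) i j
  simp only [symPart, Matrix.mul_apply, Matrix.sub_apply, Matrix.add_apply, Matrix.smul_apply,
    Matrix.transpose_apply, smul_eq_mul]
  fun_prop

/-- The map `(x, u) ↦ u - x sym(xᵀ u)`, the tangential projection for `x` on the manifold. -/
def tangent (x u : Mat d r) : Mat d r := u - ofM (toM x * symPart ((toM x)ᵀ * toM u))

lemma contDiff_tangent {N : WithTop ℕ∞} :
    ContDiff ℝ N fun q : Mat d r × Mat d r => tangent q.1 q.2 := by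
  refine contDiff_snd.sub (contDiff_ofM fun i j => ?_)
  have h := fun i j =>
    contDiff_entry (N := N) (contDiff_fst (𝕜 := ℝ) (E := Mat d r) (F := Mat d r)) i j
  have h' := fun i j =>
    contDiff_entry (N := N) (contDiff_snd (𝕜 := ℝ) (E := Mat d r) (F := Mat d r)) i j
  simp only [symPart, Matrix.mul_apply, Matrix.add_apply, Matrix.smul_apply,
    Matrix.transpose_apply, smul_eq_mul]
  fun_prop

lemma contDiff_gradC_cMap {N : WithTop ℕ∞} :
    ContDiff ℝ N fun x : Mat d r => gradC x (cMap x) := by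
  refine contDiff_ofM fun i j => ?_
  have h := fun i j => contDiff_entry (N := N) (contDiff_id (𝕜 := ℝ) (E := Mat d r)) i j
  have h' := fun i j => contDiff_entry (N := N) (contDiff_cMap (d := d) (r := r)) i j
  simp only [id] at h
  simp only [Matrix.mul_apply, Matrix.smul_apply, smul_eq_mul]
  fun_prop

lemma hasDerivAt_cubic {E : Type*} [NormedAddCommGroup E] [NormedSpace ℝ E] (a b c e : E) :
    HasDerivAt (fun t : ℝ => a + t • b + t ^ 2 • c + t ^ 3 • e) b 0 := by
  have h1 := (hasDerivAt_id (0 : ℝ)).smul_const b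
  have h2 := (hasDerivAt_pow 2 (0 : ℝ)).smul_const c
  have h3 := (hasDerivAt_pow 3 (0 : ℝ)).smul_const e
  exact (((h1.const_add a).add h2).add h3).congr_deriv (by simp)

/-- The Fréchet derivative from the derivative along a line. -/
lemma fderiv_eq_of_line {E G : Type*} [NormedAddCommGroup E] [NormedSpace ℝ E]
    [NormedAddCommGroup G] [NormedSpace ℝ G] {φ : E → G} {x v : E} {w : G}
    (hφ : DifferentiableAt ℝ φ x) (h : HasDerivAt (fun t : ℝ => φ (x + t • v)) w 0) :
    fderiv ℝ φ x v = w := by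
  rw [← hφ.lineDeriv_eq_fderiv]
  exact h.deriv

lemma fderiv_AMap (x v : Mat d r) : fderiv ℝ AMap x v = gradA x v := by
  refine fderiv_eq_of_line ((contDiff_AMap (N := 1)).differentiable one_ne_zero x) ?_
  have e : ∀ t : ℝ, AMap (x + t • v) = AMap x + t • gradA x v
      + t ^ 2 • ofM (-(1 / 2 : ℝ) • (toM x * ((toM v)ᵀ * toM v)
        + toM v * ((toM x)ᵀ * toM v + (toM v)ᵀ * toM x)))
      + t ^ 3 • ofM (-(1 / 2 : ℝ) • (toM v * ((toM v)ᵀ * toM v))) := by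
    intro t
    apply toM_injective
    simp only [AMap, gradA, symPart, toM_add, toM_ofM, toM_smul, Matrix.transpose_add,
      Matrix.transpose_smul, Matrix.mul_add, Matrix.add_mul, Matrix.mul_sub, Matrix.smul_mul,
      Matrix.mul_smul, Matrix.mul_one, Matrix.transpose_mul, Matrix.transpose_transpose]
    module
  simp only [e]
  exact hasDerivAt_cubic _ _ _ _

lemma fderiv_cMap (x v : Mat d r) :
    fderiv ℝ cMap x v = ofM ((toM x)ᵀ * toM v + (toM v)ᵀ * toM x) := by
  refine fderiv_eq_of_line ((contDiff_cMap (N := 1)).differentiable one_ne_zero x) ?_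
  have e : ∀ t : ℝ, cMap (x + t • v) = cMap x
      + t • ofM ((toM x)ᵀ * toM v + (toM v)ᵀ * toM x)
      + t ^ 2 • ofM ((toM v)ᵀ * toM v) + t ^ 3 • (0 : Mat r r) := by
    intro t
    rw [smul_zero, add_zero]
    apply toM_injective
    simp only [cMap, toM_add, toM_ofM, toM_smul, Matrix.transpose_add,
      Matrix.transpose_smul, Matrix.mul_add, Matrix.add_mul, Matrix.smul_mul, Matrix.mul_smul]
    module
  simp only [e]
  exact hasDerivAt_cubic _ _ _ _

lemma trace_symPart_mul_symPart (B D : Matrix (Fin n) (Fin n) ℝ) :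
    (symPart B * symPart D).trace = (symPart B * D).trace := by
  have h : (symPart B * Dᵀ).trace = (symPart B * D).trace := by
    rw [← Matrix.trace_transpose, Matrix.transpose_mul, Matrix.transpose_transpose,
      transpose_symPart, Matrix.trace_mul_comm]
  rw [show symPart D = (1 / 2 : ℝ) • (D + Dᵀ) from rfl, Matrix.mul_smul, Matrix.mul_add,
    Matrix.trace_smul, Matrix.trace_add, h, smul_eq_mul]
  ring

lemma inner_gradA (x u v : Mat d r) : ⟪gradA x u, v⟫ = ⟪u, gradA x v⟫ := by
  have key : ∀ u v : Mat d r, ⟪gradA x u, v⟫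
      = (3 / 2 : ℝ) * ((toM u)ᵀ * toM v).trace
        - (1 / 2 : ℝ) * (((toM x)ᵀ * toM x) * ((toM u)ᵀ * toM v)).trace
        - (symPart ((toM x)ᵀ * toM u) * symPart ((toM x)ᵀ * toM v)).trace := by
    intro u v
    rw [trace_symPart_mul_symPart, inner_eq_trace, gradA, toM_ofM, Matrix.transpose_sub,
      Matrix.transpose_mul, Matrix.transpose_mul, transpose_symPart, Matrix.transpose_sub,
      Matrix.transpose_smul, Matrix.transpose_smul, Matrix.transpose_mul,
      Matrix.transpose_transpose, Matrix.transpose_one]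
    simp only [Matrix.sub_mul, Matrix.smul_mul, Matrix.one_mul, Matrix.trace_sub,
      Matrix.trace_smul, smul_eq_mul, Matrix.mul_assoc]
  rw [key, real_inner_comm, key]
  have e : (((toM x)ᵀ * toM x) * ((toM u)ᵀ * toM v)).trace
      = (((toM x)ᵀ * toM x) * ((toM v)ᵀ * toM u)).trace := by
    rw [← Matrix.trace_transpose]
    simp only [Matrix.transpose_mul, Matrix.transpose_transpose]
    rw [Matrix.trace_mul_comm]
  rw [e, ← Matrix.trace_transpose ((toM u)ᵀ * toM v), Matrix.transpose_mul,
    Matrix.transpose_transpose, Matrix.trace_mul_comm (symPart _)]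

lemma transpose_cMap (x : Mat d r) : (toM (cMap x))ᵀ = toM (cMap x) := by
  simp [cMap]

lemma inner_cMap_fderiv (x v : Mat d r) :
    ⟪cMap x, fderiv ℝ cMap x v⟫ = ⟪gradC x (cMap x), v⟫ := by
  rw [fderiv_cMap, inner_eq_trace, inner_eq_trace, toM_ofM, gradC, toM_ofM,
    Matrix.transpose_smul, Matrix.transpose_mul, transpose_cMap, Matrix.mul_add,
    Matrix.trace_add, Matrix.smul_mul, Matrix.trace_smul]
  have e : (toM (cMap x) * ((toM v)ᵀ * toM x)).trace
      = (toM (cMap x) * ((toM x)ᵀ * toM v)).trace := by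
    rw [← Matrix.trace_transpose, Matrix.transpose_mul, transpose_cMap, Matrix.transpose_mul,
      Matrix.transpose_transpose, Matrix.trace_mul_comm]
  rw [e, smul_eq_mul, Matrix.mul_assoc]
  ring

/-- The gradient of the penalized function in `x`. -/
lemma hasGradientAt_penalized {e : ℕ} {f : Mat d r → Vec e → ℝ} (ρ : ℝ) {x : Mat d r} {y : Vec e}
    (hf : DifferentiableAt ℝ (fun x' => f x' y) (AMap x)) :
    HasGradientAt (fun x' => penalized f ρ x' y)
      (gradA x (gradX f (AMap x) y) + (ρ / 2) • gradC x (cMap x)) x := by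
  have hA := ((contDiff_AMap (d := d) (r := r) (N := 1)).differentiable one_ne_zero x).hasFDerivAt
  have hc := ((contDiff_cMap (d := d) (r := r) (N := 1)).differentiable one_ne_zero x).hasFDerivAt
  have h1 := hf.hasGradientAt.hasFDerivAt.comp x hA
  have h2 := (hc.norm_sq).const_mul (ρ / 4)
  refine (h1.add h2).congr_fderiv ?_
  ext v
  simp only [_root_.add_apply, ContinuousLinearMap.comp_apply,
    _root_.smul_apply, InnerProductSpace.toDual_apply_apply, fderiv_AMap,
    innerSL_apply_apply, inner_cMap_fderiv, inner_add_left, inner_smul_left, inner_gradA,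
    conj_trivial, smul_eq_mul, nsmul_eq_mul]
  rw [gradX]
  push_cast
  ring

lemma gradX_penalized {e : ℕ} {f : Mat d r → Vec e → ℝ} (ρ : ℝ) {x : Mat d r} {y : Vec e}
    (hf : DifferentiableAt ℝ (fun x' => f x' y) (AMap x)) :
    gradX (penalized f ρ) x y
      = gradA x (gradX f (AMap x) y) + (ρ / 2) • gradC x (cMap x) :=
  (hasGradientAt_penalized ρ hf).gradient

lemma gradY_penalized {e : ℕ} (f : Mat d r → Vec e → ℝ) (ρ : ℝ) (x : Mat d r) (y : Vec e) :
    gradY (penalized f ρ) x y = gradY f (AMap x) y := by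
  unfold gradY gradient penalized
  rw [fderiv_add_const]

/-- A `C¹` map is Lipschitz on bounded sets. -/
lemma exists_lipschitz_of_contDiff {E G : Type*} [NormedAddCommGroup E] [NormedSpace ℝ E]
    [FiniteDimensional ℝ E] [NormedAddCommGroup G] [NormedSpace ℝ G] {φ : E → G}
    (hφ : ContDiff ℝ 1 φ) {s : Set E} (hs : Bornology.IsBounded s) :
    ∃ K : ℝ, 0 ≤ K ∧ ∀ a ∈ s, ∀ b ∈ s, ‖φ a - φ b‖ ≤ K * ‖a - b‖ := by
  have := FiniteDimensional.proper ℝ E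
  obtain ⟨K, hK⟩ := (hφ.locallyLipschitz.locallyLipschitzOn
    (s := closure s)).exists_lipschitzOnWith_of_compact hs.isCompact_closure
  refine ⟨K, K.2, fun a ha b hb => ?_⟩
  simpa [dist_eq_norm] using hK.dist_le_mul a (subset_closure ha) b (subset_closure hb)

end Matrices

/-! ### Projection onto the Stiefel manifold -/

section Polar

open scoped RealInnerProductSpace Matrix MatrixOrder

variable {d r : ℕ}

lemma mem_stiefel_iff {x : Mat d r} : x ∈ stiefel d r ↔ (toM x)ᵀ * toM x = 1 := Iff.rfl

lemma trace_mul_mul_transpose_nonneg {m n : ℕ} {H : Matrix (Fin n) (Fin n) ℝ}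
    (hH : H.PosSemidef) (Z : Matrix (Fin m) (Fin n) ℝ) : 0 ≤ (Z * H * Zᵀ).trace := by
  have := (hH.mul_mul_conjTranspose_same Z).trace_nonneg
  rwa [Matrix.conjTranspose_eq_transpose_of_trivial] at this

lemma exists_symm_sqrt {n : ℕ} {S : Matrix (Fin n) (Fin n) ℝ} (hS : S.PosSemidef) :
    ∃ H : Matrix (Fin n) (Fin n) ℝ, H.PosSemidef ∧ Hᵀ = H ∧ H * H = S := by
  have hH := Matrix.nonneg_iff_posSemidef.1 (CFC.sqrt_nonneg S)
  refine ⟨_, hH, ?_, CFC.sqrt_mul_sqrt_self S hS.nonneg⟩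
  have := hH.isHermitian
  rwa [Matrix.IsHermitian, Matrix.conjTranspose_eq_transpose_of_trivial] at this

lemma posSemidef_transpose_mul_self {m n : ℕ} (M : Matrix (Fin m) (Fin n) ℝ) :
    (Mᵀ * M).PosSemidef := by
  have := Matrix.posSemidef_conjTranspose_mul_self M
  rwa [Matrix.conjTranspose_eq_transpose_of_trivial] at this

/-- The square root of `xᵀ x`, near the manifold. -/
lemma exists_sqrt {x : Mat d r} (hx : ‖cMap x‖ < 1) :
    ∃ H : Matrix (Fin r) (Fin r) ℝ, H.PosSemidef ∧ Hᵀ = H ∧ IsUnit H.det ∧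
      H * H = (toM x)ᵀ * toM x := by
  obtain ⟨H, hH, hT, hHH⟩ := exists_symm_sqrt (posSemidef_transpose_mul_self (toM x))
  refine ⟨H, hH, hT, ?_, hHH⟩
  have h1 : IsUnit ((toM x)ᵀ * toM x) := by
    have := isUnit_one_add_of_norm_lt (M := (toM x)ᵀ * toM x - 1) hx
    rwa [add_sub_cancel] at this
  rw [← hHH, Matrix.isUnit_iff_isUnit_det, Matrix.det_mul] at h1
  exact isUnit_of_mul_isUnit_left h1

lemma eq_zero_of_trace_eq_zero {m n : ℕ} {H : Matrix (Fin n) (Fin n) ℝ} (hH : H.PosSemidef)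
    (hu : IsUnit H.det) {Z : Matrix (Fin m) (Fin n) ℝ} (h : (Z * H * Zᵀ).trace = 0) : Z = 0 := by
  obtain ⟨B, -, hB, hBB⟩ := exists_symm_sqrt hH
  have h1 : ‖ofM (Z * B)‖ ^ 2 = 0 := by
    rw [norm_sq_eq_trace, toM_ofM, Matrix.trace_mul_comm, Matrix.transpose_mul, hB,
      Matrix.mul_assoc, ← Matrix.mul_assoc B, hBB, ← Matrix.mul_assoc, h]
  have h2 : Z * B = 0 := congrArg toM (norm_eq_zero.1 (pow_eq_zero_iff two_ne_zero |>.1 h1))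
  rw [← Matrix.mul_one Z, ← Matrix.mul_nonsing_inv H hu, ← Matrix.mul_assoc, ← hBB,
    ← Matrix.mul_assoc, h2, Matrix.zero_mul, Matrix.zero_mul]

/-- Near the Stiefel manifold the projection is unique and at most `‖c(x)‖` away. -/
theorem exists_unique_proj {x : Mat d r} (hx : ‖cMap x‖ < 1) :
    ∃ q ∈ stiefel d r, (∀ q', IsProj (stiefel d r) x q' ↔ q' = q) ∧ ‖x - q‖ ≤ ‖cMap x‖ := by
  obtain ⟨H, hH, hT, hu, hHH⟩ := exists_sqrt hx
  have hinv : H⁻¹ * H = 1 := Matrix.nonsing_inv_mul _ hu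
  have hinv' : H * H⁻¹ = 1 := Matrix.mul_nonsing_inv _ hu
  have hTinv : (H⁻¹)ᵀ = H⁻¹ := by rw [Matrix.transpose_nonsing_inv, hT]
  obtain ⟨Q, hQ⟩ : ∃ Q, Q = toM x * H⁻¹ := ⟨_, rfl⟩
  have hQH : Q * H = toM x := by rw [hQ, Matrix.mul_assoc, hinv, Matrix.mul_one]
  have hQQ : Qᵀ * Q = 1 := by
    rw [hQ, Matrix.transpose_mul, hTinv, Matrix.mul_assoc, ← Matrix.mul_assoc (toM x)ᵀ, ← hHH,
      Matrix.mul_assoc, hinv', Matrix.mul_one, hinv]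
  have hq : ofM Q ∈ stiefel d r := hQQ
  have hdist : ∀ q' ∈ stiefel d r, ‖x - q'‖ ^ 2 - ‖x - ofM Q‖ ^ 2
      = ((Q - toM q') * H * (Q - toM q')ᵀ).trace := by
    intro q' hq'
    rw [mem_stiefel_iff] at hq'
    have e1 : ‖q'‖ ^ 2 = ‖ofM Q‖ ^ 2 := by
      rw [norm_sq_eq_trace, norm_sq_eq_trace, hq', toM_ofM, hQQ]
    have e2 : ((Q - toM q') * H * (Q - toM q')ᵀ).trace
        = 2 * ((toM x)ᵀ * Q).trace - 2 * ((toM x)ᵀ * toM q').trace := by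
      have a1 : ∀ M N : Matrix (Fin d) (Fin r) ℝ, (M * H * Nᵀ).trace = (H * (Nᵀ * M)).trace := by
        intro M N
        rw [Matrix.mul_assoc, Matrix.trace_mul_comm, Matrix.mul_assoc]
      have a2 : (toM x)ᵀ = H * Qᵀ := by rw [← hQH, Matrix.transpose_mul, hT]
      have a3 : (H * ((toM q')ᵀ * Q)).trace = (H * (Qᵀ * toM q')).trace := by
        rw [← Matrix.trace_transpose, Matrix.transpose_mul, Matrix.transpose_mul,
          Matrix.transpose_transpose, hT, Matrix.trace_mul_comm]
      rw [a1, Matrix.transpose_sub, Matrix.sub_mul, Matrix.mul_sub Qᵀ, Matrix.mul_sub (toM q')ᵀ, hq', hQQ,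
        a2, Matrix.mul_sub, Matrix.mul_sub, Matrix.mul_sub, Matrix.trace_sub, Matrix.trace_sub,
        Matrix.trace_sub, a3, Matrix.mul_assoc, Matrix.mul_assoc, hQQ]
      ring
    rw [norm_sub_sq_real, norm_sub_sq_real, e1, e2, inner_eq_trace, inner_eq_trace, toM_ofM]
    ring
  refine ⟨ofM Q, hq, fun q' => ⟨fun h => ?_, ?_⟩, ?_⟩
  · have h1 := h.2 _ hq
    have h2 : ‖x - q'‖ ^ 2 ≤ ‖x - ofM Q‖ ^ 2 := by gcongr
    have h3 := hdist q' h.1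
    have h4 := trace_mul_mul_transpose_nonneg hH (Q - toM q')
    have h5 : ((Q - toM q') * H * (Q - toM q')ᵀ).trace = 0 := by linarith
    have h6 : Q - toM q' = 0 := eq_zero_of_trace_eq_zero hH hu h5
    refine toM_injective ?_
    rw [toM_ofM]
    exact (sub_eq_zero.1 h6).symm
  · rintro rfl
    refine ⟨hq, fun q' hq' => ?_⟩
    have h3 := hdist q' hq'
    have h4 := trace_mul_mul_transpose_nonneg hH (Q - toM q')
    exact (sq_le_sq₀ (norm_nonneg _) (norm_nonneg _)).1 (by linarith)
  · refine (sq_le_sq₀ (norm_nonneg _) (norm_nonneg _)).1 ?_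
    have e1 : toM (x - ofM Q) = Q * (H - 1) := by
      rw [toM_sub, toM_ofM, Matrix.mul_sub, Matrix.mul_one, hQH]
    have e2 : toM (cMap x) = H * H - 1 := by rw [hHH]; rfl
    have hPSD : (H + H + H * H).PosSemidef := by
      have := posSemidef_transpose_mul_self H
      rw [hT] at this
      exact (hH.add hH).add this
    have h1 := trace_mul_mul_transpose_nonneg hPSD (H - 1)
    rw [norm_sq_eq_trace, norm_sq_eq_trace, e1, e2, Matrix.transpose_mul, Matrix.mul_assoc,
      ← Matrix.mul_assoc Qᵀ, hQQ, Matrix.one_mul]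
    have e3 : (H * H - 1)ᵀ * (H * H - 1)
        = (H - 1)ᵀ * (H - 1) + (H - 1) * (H + H + H * H) * (H - 1)ᵀ := by
      rw [Matrix.transpose_sub, Matrix.transpose_sub, Matrix.transpose_mul, Matrix.transpose_one,
        hT]
      noncomm_ring
    rw [e3, Matrix.trace_add]
    linarith

end Polar

/-! ### Stationarity of the penalized function near the manifold -/

section NearManifold

open scoped RealInnerProductSpace Matrix

variable {d r : ℕ}

lemma gradA_eq_tangent_sub (x u : Mat d r) :
    gradA x u = tangent x u - (1 / 2 : ℝ) • ofM (toM u * toM (cMap x)) := by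
  apply toM_injective
  simp only [gradA, tangent, cMap, toM_sub, toM_ofM, toM_smul, Matrix.mul_sub, Matrix.mul_smul,
    Matrix.mul_one]
  module

lemma gradC_cMap (x : Mat d r) : gradC x (cMap x) = (2 : ℝ) • ofM (toM x * toM (cMap x)) := rfl

/-- The constraint violation is controlled by the gradient of the penalized function. -/
lemma norm_cMap_le {x u w : Mat d r} {C G ρ : ℝ} (hx : ‖x‖ ≤ C) (hu : ‖u‖ ≤ G)
    (hc : ‖cMap x‖ ≤ 1 / 2) (hρ : 6 * C * G ≤ ρ) (hρ0 : 0 ≤ ρ)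
    (hw : w = gradA x u + (ρ / 2) • gradC x (cMap x)) : ρ / 4 * ‖cMap x‖ ≤ C * ‖w‖ := by
  have hC : 0 ≤ C := (norm_nonneg _).trans hx
  have hG : 0 ≤ G := (norm_nonneg _).trans hu
  have hS : (toM x)ᵀ * toM x = 1 + toM (cMap x) := by
    simp [cMap]
  have hsym := transpose_cMap x
  set c := toM (cMap x) with hcdef
  set B := (toM x)ᵀ * toM u with hB
  have hxw : (toM x)ᵀ * toM w = B - (1 / 2 : ℝ) • (B * c) - (1 + c) * symPart B
      + ρ • (c + c * c) := by
    rw [hw, gradA_eq_tangent_sub, gradC_cMap]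
    simp only [tangent, toM_add, toM_sub, toM_smul, toM_ofM, Matrix.mul_add, Matrix.mul_sub,
      Matrix.mul_smul, ← Matrix.mul_assoc, hS, ← hB, ← hcdef, Matrix.add_mul, Matrix.one_mul]
    module
  have key : ρ • c = symPart ((toM x)ᵀ * toM w) + (1 / 2 : ℝ) • symPart (B * c)
      + symPart (c * symPart B) - ρ • (c * c) := by
    rw [hxw]
    simp only [symPart, Matrix.transpose_add, Matrix.transpose_sub, Matrix.transpose_smul,
      Matrix.transpose_mul, Matrix.transpose_transpose, hsym,
      Matrix.add_mul, Matrix.mul_add, Matrix.one_mul,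
      Matrix.mul_smul]
    module
  have hBn : ‖ofM B‖ ≤ C * G := by
    refine (norm_ofM_mul_le _ _).trans ?_
    rw [norm_ofM_transpose, ofM_toM, ofM_toM]
    gcongr
  have hcc : ofM c = cMap x := rfl
  have b1 : ‖ofM (symPart ((toM x)ᵀ * toM w))‖ ≤ C * ‖w‖ := by
    refine (norm_symPart_le _).trans ((norm_ofM_mul_le _ _).trans ?_)
    rw [norm_ofM_transpose, ofM_toM, ofM_toM]
    gcongr
  have b2 : ‖ofM (symPart (B * c))‖ ≤ C * G * ‖cMap x‖ := by
    refine (norm_symPart_le _).trans ((norm_ofM_mul_le _ _).trans ?_)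
    rw [hcc]
    gcongr
  have b3 : ‖ofM (symPart (c * symPart B))‖ ≤ ‖cMap x‖ * (C * G) := by
    refine (norm_symPart_le _).trans ((norm_ofM_mul_le _ _).trans ?_)
    rw [hcc]
    gcongr
    exact (norm_symPart_le _).trans hBn
  have b4 : ‖ofM (c * c)‖ ≤ ‖cMap x‖ * (1 / 2) := by
    refine (norm_ofM_mul_le _ _).trans ?_
    rw [hcc]
    gcongr
  have hn := congrArg (fun M => ‖ofM M‖) key
  simp only [ofM_sub, ofM_add, ofM_smul, norm_smul, Real.norm_eq_abs, abs_of_nonneg hρ0] at hn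
  rw [hcc] at hn
  have n1 := norm_sub_le (ofM (symPart ((toM x)ᵀ * toM w)) + (1 / 2 : ℝ) • ofM (symPart (B * c))
      + ofM (symPart (c * symPart B))) (ρ • ofM (c * c))
  have n2 := norm_add_le (ofM (symPart ((toM x)ᵀ * toM w))
    + (1 / 2 : ℝ) • ofM (symPart (B * c))) (ofM (symPart (c * symPart B)))
  have n3 := norm_add_le (ofM (symPart ((toM x)ᵀ * toM w)))
    ((1 / 2 : ℝ) • ofM (symPart (B * c)))
  rw [norm_smul, Real.norm_of_nonneg hρ0] at n1
  rw [norm_smul, Real.norm_of_nonneg (by norm_num)] at n3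
  have n4 : ρ * ‖ofM (c * c)‖ ≤ ρ * (‖cMap x‖ * (1 / 2)) := by gcongr
  have n5 : 6 * C * G * ‖cMap x‖ ≤ ρ * ‖cMap x‖ := by gcongr
  linarith

lemma norm_tangent_le {x u w : Mat d r} {C G ρ : ℝ} (hx : ‖x‖ ≤ C) (hu : ‖u‖ ≤ G)
    (hρ0 : 0 ≤ ρ) (hw : w = gradA x u + (ρ / 2) • gradC x (cMap x)) :
    ‖tangent x u‖ ≤ ‖w‖ + (G / 2 + ρ * C) * ‖cMap x‖ := by
  have e : tangent x u = w + (1 / 2 : ℝ) • ofM (toM u * toM (cMap x))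
      - ρ • ofM (toM x * toM (cMap x)) := by
    rw [hw, gradA_eq_tangent_sub, gradC_cMap]
    module
  have b1 : ‖ofM (toM u * toM (cMap x))‖ ≤ G * ‖cMap x‖ := by
    refine (norm_ofM_mul_le _ _).trans ?_
    rw [ofM_toM, ofM_toM]
    gcongr
  have b2 : ‖ofM (toM x * toM (cMap x))‖ ≤ C * ‖cMap x‖ := by
    refine (norm_ofM_mul_le _ _).trans ?_
    rw [ofM_toM, ofM_toM]
    gcongr
  rw [e]
  have n1 := norm_sub_le (w + (1 / 2 : ℝ) • ofM (toM u * toM (cMap x)))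
    (ρ • ofM (toM x * toM (cMap x)))
  have n2 := norm_add_le w ((1 / 2 : ℝ) • ofM (toM u * toM (cMap x)))
  rw [norm_smul, Real.norm_of_nonneg hρ0] at n1
  rw [norm_smul, Real.norm_of_nonneg (by norm_num)] at n2
  have n3 := mul_le_mul_of_nonneg_left b2 hρ0
  linarith

/-- `A` fixes the manifold. -/
lemma AMap_of_mem {x : Mat d r} (hx : x ∈ stiefel d r) : AMap x = x := by
  apply toM_injective
  rw [mem_stiefel_iff] at hx
  simp only [AMap, toM_ofM, hx, ← sub_smul, Matrix.mul_smul, Matrix.mul_one]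
  norm_num

lemma cMap_of_mem {x : Mat d r} (hx : x ∈ stiefel d r) : cMap x = 0 := by
  apply toM_injective
  rw [mem_stiefel_iff] at hx
  rw [cMap, hx, sub_self]
  rfl

lemma norm_of_mem {x : Mat d r} (hx : x ∈ stiefel d r) : ‖x‖ = √r := by
  rw [mem_stiefel_iff] at hx
  rw [← Real.sqrt_sq (norm_nonneg x), norm_sq_eq_trace, hx]
  simp

lemma norm_le_sSup {x : Mat d r} (hx : x ∈ stiefel d r) :
    ‖x‖ ≤ sSup ((fun x => ‖x‖) '' stiefel d r) := by
  refine le_csSup ⟨√r, ?_⟩ ⟨x, hx, rfl⟩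
  rintro _ ⟨y, hy, rfl⟩
  exact (norm_of_mem hy).le

end NearManifold

/-! ### Functions with Lipschitz gradient -/

section Smooth

open scoped RealInnerProductSpace

lemma abs_expand_le {E : Type*} [NormedAddCommGroup E] [InnerProductSpace ℝ E] [CompleteSpace E]
    {φ : E → ℝ} {φ' : E → E} {X : Set E} {l : ℝ} (hX : Convex ℝ X)
    (hφ : ∀ x ∈ X, HasGradientAt φ (φ' x) x)
    (hl : ∀ a ∈ X, ∀ b ∈ X, ‖φ' a - φ' b‖ ≤ l * ‖a - b‖) {a b : E} (ha : a ∈ X) (hb : b ∈ X) :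
    |φ b - φ a - ⟪φ' a, b - a⟫| ≤ l / 2 * ‖b - a‖ ^ 2 := by
  have hm : ∀ t ∈ Set.Icc (0 : ℝ) 1, a + t • (b - a) ∈ X := fun t ht =>
    hX.add_smul_sub_mem ha hb ht
  have hd : ∀ t ∈ Set.Icc (0 : ℝ) 1, HasDerivAt
      (fun t : ℝ => φ (a + t • (b - a)) - φ a - t * ⟪φ' a, b - a⟫)
      (⟪φ' (a + t • (b - a)) - φ' a, b - a⟫) t := by
    intro t ht
    have h1 : HasDerivAt (fun t : ℝ => a + t • (b - a)) (b - a) t := by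
      simpa using ((hasDerivAt_id t).smul_const (b - a)).const_add a
    have h2 := (hφ _ (hm t ht)).hasFDerivAt.comp_hasDerivAt t h1
    refine ((h2.sub_const (φ a)).sub ((hasDerivAt_id t).mul_const ⟪φ' a, b - a⟫)).congr_deriv ?_
    simp [inner_sub_left]
  have key := image_norm_le_of_norm_deriv_right_le_deriv_boundary
    (f := fun t : ℝ => φ (a + t • (b - a)) - φ a - t * ⟪φ' a, b - a⟫)
    (f' := fun t => ⟪φ' (a + t • (b - a)) - φ' a, b - a⟫) (a := 0) (b := 1)
    (B := fun t => l / 2 * ‖b - a‖ ^ 2 * t ^ 2) (B' := fun t => l * ‖b - a‖ ^ 2 * t)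
    (fun t ht => (hd t ht).continuousAt.continuousWithinAt)
    (fun t ht => (hd t ⟨ht.1, ht.2.le⟩).hasDerivWithinAt) (by simp)
    (fun t => ((hasDerivAt_pow 2 t).const_mul _).congr_deriv (by push_cast; ring))
    (fun t ht => by
      rw [Real.norm_eq_abs]
      refine (abs_real_inner_le_norm _ _).trans ?_
      have h := hl _ (hm t ⟨ht.1, ht.2.le⟩) a ha
      rw [add_sub_cancel_left, norm_smul, Real.norm_of_nonneg ht.1] at h
      calc _ ≤ (l * (t * ‖b - a‖)) * ‖b - a‖ := by gcongr
        _ = _ := by ring)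
    (show (1 : ℝ) ∈ Set.Icc (0 : ℝ) 1 by simp)
  simpa using key

/-- One of the decrements of a function that is bounded below is small. -/
lemma exists_decrement_le {V a : ℕ → ℝ} {m : ℝ} (hV : ∀ t, V (t + 1) + a t ≤ V t)
    (hm : ∀ t, m ≤ V t) {T : ℕ} (hT : 0 < T) : ∃ t < T, a t ≤ (V 0 - m) / T := by
  by_contra! h
  have hsum : ∀ n, V n + ∑ t ∈ Finset.range n, a t ≤ V 0 := by
    intro n
    induction n with
    | zero => simp
    | succ n ih =>
      rw [Finset.sum_range_succ]
      linarith [hV n]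
  have h1 : ∑ t ∈ Finset.range T, (V 0 - m) / T < ∑ t ∈ Finset.range T, a t :=
    Finset.sum_lt_sum_of_nonempty (Finset.nonempty_range_iff.2 hT.ne')
      fun t ht => h t (Finset.mem_range.1 ht)
  have hT' : (T : ℝ) ≠ 0 := by positivity
  rw [Finset.sum_const, Finset.card_range, nsmul_eq_mul, mul_div_cancel₀ _ hT'] at h1
  linarith [hsum T, hm T]

end Smooth

/-! ### The regularizer and the regularized coupling function -/

section Instances

open scoped RealInnerProductSpace

variable {d r e : ℕ}

namespace IsRegularizer

variable {h : Vec e → EReal}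

lemma coe_toReal (hh : IsRegularizer h) {y : Vec e} (hy : y ∈ dom h) :
    (((h y).toReal : ℝ) : EReal) = h y :=
  EReal.coe_toReal (ne_of_lt hy) (hh.ne_bot y)

lemma convexOn (hh : IsRegularizer h) : ConvexOn ℝ (dom h) fun y => (h y).toReal := by
  have key : ∀ y ∈ dom h, ∀ w ∈ dom h, ∀ a b : ℝ, 0 ≤ a → 0 ≤ b → a + b = 1 →
      h (a • y + b • w) ≤ ((a * (h y).toReal + b * (h w).toReal : ℝ) : EReal) := by
    intro y hy w hw a b ha hb hab
    have := hh.convex_epigraph (x := (y, (h y).toReal)) (by simp [hh.coe_toReal hy])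
      (y := (w, (h w).toReal)) (by simp [hh.coe_toReal hw]) ha hb hab
    simpa using this
  have hconv : Convex ℝ (dom h) := fun y hy w hw a b ha hb hab =>
    (key y hy w hw a b ha hb hab).trans_lt (EReal.coe_lt_top _)
  refine ⟨hconv, fun y hy w hw a b ha hb hab => ?_⟩
  have h1 := key y hy w hw a b ha hb hab
  rw [← hh.coe_toReal (hconv hy hw ha hb hab)] at h1
  simpa using EReal.coe_le_coe_iff.1 h1

lemma continuousOn (hh : IsRegularizer h) : ContinuousOn (fun y => (h y).toReal) (dom h) :=
  hh.locallyLipschitz.continuousOn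

lemma isCompact_dom (hh : IsRegularizer h) : IsCompact (dom h) :=
  Metric.isCompact_of_isClosed_isBounded hh.isClosed_dom hh.isBounded_dom

lemma eq_top (h : Vec e → EReal) {y : Vec e} (hy : y ∉ dom h) : h y = ⊤ :=
  not_lt_top_iff.1 hy

/-- Existence of proximal points. -/
lemma exists_isProx (hh : IsRegularizer h) {τ : ℝ} (hτ : 0 < τ) (u : Vec e) :
    ∃ p, IsProx τ h u p := by
  have hc : ContinuousOn (fun y => τ * (h y).toReal + ‖y - u‖ ^ 2 / 2) (dom h) := by
    have := hh.continuousOn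
    fun_prop
  obtain ⟨p, hp, hmin⟩ := hh.isCompact_dom.exists_isMinOn hh.nonempty_dom hc
  refine ⟨p, fun w => ?_⟩
  by_cases hw : w ∈ dom h
  · rw [← hh.coe_toReal hp, ← hh.coe_toReal hw]
    exact_mod_cast hmin hw
  · rw [eq_top h hw, EReal.coe_mul_top_of_pos hτ]
    simp

lemma mem_dom_of_isProx (hh : IsRegularizer h) {τ : ℝ} (hτ : 0 < τ) {u p : Vec e}
    (hp : IsProx τ h u p) : p ∈ dom h := by
  obtain ⟨w, hw⟩ := hh.nonempty_dom
  by_contra hn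
  have h1 := hp w
  rw [eq_top h hn, EReal.coe_mul_top_of_pos hτ, ← hh.coe_toReal hw, EReal.top_add_coe,
    top_le_iff] at h1
  exact EReal.coe_ne_top (τ * (h w).toReal + ‖w - u‖ ^ 2 / 2) (by exact_mod_cast h1)

/-- The variational inequality of the proximal map. -/
lemma le_of_isProx (hh : IsRegularizer h) {τ : ℝ} (hτ : 0 < τ) {u p : Vec e}
    (hp : IsProx τ h u p) {w : Vec e} (hw : w ∈ dom h) :
    (h p).toReal + ⟪τ⁻¹ • (u - p), w - p⟫ ≤ (h w).toReal := by
  have hpd := hh.mem_dom_of_isProx hτ hp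
  have key : 0 ≤ τ * ((h w).toReal - (h p).toReal) - ⟪u - p, w - p⟫ := by
    refine nonneg_of_forall_small (c := ‖w - p‖ ^ 2 / 2) fun θ h0 h1 => ?_
    have hm := hh.convexOn.1.add_smul_sub_mem hpd hw ⟨h0.le, h1⟩
    have h2 := hp (p + θ • (w - p))
    rw [← hh.coe_toReal hpd, ← hh.coe_toReal hm] at h2
    have h3 : τ * (h p).toReal + ‖p - u‖ ^ 2 / 2
      ≤ τ * (h (p + θ • (w - p))).toReal + ‖p + θ • (w - p) - u‖ ^ 2 / 2 := by exact_mod_cast h2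
    have h4 := hh.convexOn.2 hpd hw (by linarith : 0 ≤ 1 - θ) h0.le (by ring)
    have e1 : (1 - θ) • p + θ • w = p + θ • (w - p) := by module
    have e2 : p + θ • (w - p) - u = θ • (w - p) - (u - p) := by module
    rw [e1] at h4
    rw [e2, norm_sub_sq_real (θ • (w - p)), norm_smul, mul_pow, Real.norm_eq_abs, sq_abs,
      inner_smul_left, real_inner_comm, norm_sub_rev p u] at h3
    simp only [smul_eq_mul, conj_trivial] at h3 h4
    have h5 := mul_le_mul_of_nonneg_left h4 hτ.le
    linarith
  rw [inner_smul_left, conj_trivial]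
  have h6 : τ⁻¹ * ⟪u - p, w - p⟫ ≤ τ⁻¹ * (τ * ((h w).toReal - (h p).toReal)) := by
    gcongr
    linarith
  rw [inv_mul_cancel_left₀ hτ.ne'] at h6
  linarith

lemma mem_subdiff (hh : IsRegularizer h) {p v : Vec e} (hp : p ∈ dom h)
    (hv : ∀ w ∈ dom h, (h p).toReal + ⟪v, w - p⟫ ≤ (h w).toReal) : v ∈ subdiff h p := by
  intro w
  by_cases hw : w ∈ dom h
  · rw [← hh.coe_toReal hp, ← hh.coe_toReal hw]
    exact_mod_cast hv w hw
  · rw [eq_top h hw]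
    exact le_top

end IsRegularizer

lemma dist_dom_le {h : Vec e → EReal} (hh : IsRegularizer h) {y a : Vec e} (hy : y ∈ dom h)
    (ha : a ∈ dom h) : ‖y - a‖ ≤ Metric.diam (dom h) := by
  rw [← dist_eq_norm]
  exact Metric.dist_le_diam_of_mem hh.isBounded_dom hy ha

lemma isBounded_ballX {C : ℝ} : Bornology.IsBounded (ballX d r C) :=
  (Metric.isBounded_closedBall (x := (0 : Mat d r)) (r := C)).subset fun x hx => by
    simpa [ballX] using hx

lemma convex_ballX {C : ℝ} : Convex ℝ (ballX d r C) := by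
  have : ballX d r C = Metric.closedBall 0 C := by
    ext x
    simp [ballX]
  rw [this]
  exact convex_closedBall _ _

lemma isCompact_ballX {C : ℝ} : IsCompact (ballX d r C) := by
  have : ballX d r C = Metric.closedBall 0 C := by
    ext x
    simp [ballX]
  rw [this]
  exact isCompact_closedBall _ _

lemma isCompact_barX {C : ℝ} : IsCompact (barX d r C) :=
  isCompact_ballX.image (contDiff_AMap (N := 1)).continuous

namespace IsInstance

variable {C : ℝ} {f : Mat d r → Vec e → ℝ} {h : Vec e → EReal}

lemma diam_pos (hI : IsInstance C f h) : 0 < Metric.diam (dom h) :=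
  Metric.diam_pos hI.nontrivial_dom hI.regularizer.isBounded_dom

lemma differentiableAt (hI : IsInstance C f h) {x : Mat d r} {y : Vec e} (hx : x ∈ barX d r C)
    (hy : y ∈ dom h) : DifferentiableAt ℝ (fun q : Mat d r × Vec e => f q.1 q.2) (x, y) := by
  obtain ⟨U, hU, hsub, hd⟩ := hI.smooth.1
  exact hd.differentiableAt (hU.mem_nhds (hsub ⟨hx, hy⟩))

lemma differentiableAt_left (hI : IsInstance C f h) {x : Mat d r} {y : Vec e}
    (hx : x ∈ barX d r C) (hy : y ∈ dom h) : DifferentiableAt ℝ (fun x' => f x' y) x :=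
  (hI.differentiableAt hx hy).comp (f := fun x' => (x', y)) x (by fun_prop)

lemma differentiableAt_right (hI : IsInstance C f h) {x : Mat d r} {y : Vec e}
    (hx : x ∈ barX d r C) (hy : y ∈ dom h) : DifferentiableAt ℝ (fun y' => f x y') y :=
  (hI.differentiableAt hx hy).comp (f := fun y' => (x, y')) y (by fun_prop)

lemma continuousOn (hI : IsInstance C f h) :
    ContinuousOn (fun q : Mat d r × Vec e => f q.1 q.2) (barX d r C ×ˢ dom h) :=
  fun _ hq => (hI.differentiableAt hq.1 hq.2).continuousAt.continuousWithinAt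

lemma differentiableAt_tikhonov_left (hI : IsInstance C f h) (a : Vec e) (ε : ℝ) {x : Mat d r}
    {y : Vec e} (hx : x ∈ barX d r C) (hy : y ∈ dom h) :
    DifferentiableAt ℝ (fun x' => tikhonov f h a ε x' y) x :=
  (hI.differentiableAt_left hx hy).sub_const _

end IsInstance

lemma gradX_tikhonov (f : Mat d r → Vec e → ℝ) (h : Vec e → EReal) (a : Vec e) (ε : ℝ)
    (x : Mat d r) (y : Vec e) : gradX (tikhonov f h a ε) x y = gradX f x y := by
  unfold gradX gradient tikhonov
  rw [fderiv_sub_const]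

lemma gradY_tikhonov {f : Mat d r → Vec e → ℝ} (h : Vec e → EReal) (a : Vec e) (ε : ℝ)
    {x : Mat d r} {y : Vec e} (hf : DifferentiableAt ℝ (fun y' => f x y') y) :
    gradY (tikhonov f h a ε) x y
      = gradY f x y - (ε / (2 * Metric.diam (dom h))) • (y - a) := by
  refine HasGradientAt.gradient ?_
  have h1 := hf.hasGradientAt.hasFDerivAt
  have h2 := (((hasFDerivAt_id (𝕜 := ℝ) y).sub_const a).norm_sq).const_mul
    (ε / (4 * Metric.diam (dom h)))
  refine (h1.sub h2).congr_fderiv ?_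
  ext v
  simp only [gradY, _root_.sub_apply, _root_.smul_apply, ContinuousLinearMap.comp_apply,
    InnerProductSpace.toDual_apply_apply, innerSL_apply_apply, inner_sub_left, inner_smul_left,
    conj_trivial, smul_eq_mul, nsmul_eq_mul, ContinuousLinearMap.id_apply, id]
  push_cast
  ring

namespace IsInstance

variable {C : ℝ} {f : Mat d r → Vec e → ℝ} {h : Vec e → EReal}

/-- The first-order form of the strong concavity of the regularized function. -/
lemma tikhonov_le (hI : IsInstance C f h) (a : Vec e) (ε : ℝ) {x : Mat d r} {y w : Vec e}
    (hx : x ∈ barX d r C) (hy : y ∈ dom h) (hw : w ∈ dom h) :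
    tikhonov f h a ε x w ≤ tikhonov f h a ε x y + ⟪gradY (tikhonov f h a ε) x y, w - y⟫
      - ε / (2 * Metric.diam (dom h)) / 2 * ‖w - y‖ ^ 2 := by
  have h1 := hI.concave x hx y hy w hw
  have hD := hI.diam_pos
  have e1 : w - a = (y - a) + (w - y) := by abel
  rw [gradY_tikhonov h a ε (hI.differentiableAt_right hx hy), inner_sub_left, inner_smul_left,
    conj_trivial]
  unfold tikhonov
  rw [e1, norm_add_sq_real]
  have e2 : ε / (4 * Metric.diam (dom h)) = ε / (2 * Metric.diam (dom h)) / 2 := by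
    field_simp
    norm_num
  rw [e2]
  linarith

/-- The regularized problem is strongly concave in `y`. -/
lemma strongConcaveOn (hI : IsInstance C f h) (a : Vec e) (ε : ℝ) {x : Mat d r}
    (hx : x ∈ barX d r C) :
    StrongConcaveOn (dom h) (ε / (2 * Metric.diam (dom h)))
      fun y => tikhonov f h a ε x y - (h y).toReal := by
  have hconv := hI.regularizer.convexOn
  refine ⟨hconv.1, fun y hy w hw s t hs ht hst => ?_⟩
  have hm := hconv.1 hy hw hs ht hst
  have c1 := hI.tikhonov_le a ε hx hm hy
  have c2 := hI.tikhonov_le a ε hx hm hw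
  have c3 := hconv.2 hy hw hs ht hst
  obtain rfl : s = 1 - t := by linarith
  have e1 : y - ((1 - t) • y + t • w) = t • (y - w) := by module
  have e2 : w - ((1 - t) • y + t • w) = -((1 - t) • (y - w)) := by module
  rw [e1, inner_smul_right, norm_smul, mul_pow, Real.norm_eq_abs, sq_abs] at c1
  rw [e2, inner_neg_right, inner_smul_right, norm_neg, norm_smul, mul_pow, Real.norm_eq_abs,
    sq_abs] at c2
  have d1 := mul_le_mul_of_nonneg_left c1 hs
  have d2 := mul_le_mul_of_nonneg_left c2 ht
  simp only [smul_eq_mul] at c3 ⊢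
  nlinarith

/-- The gradient of the regularized penalized function in `x` does not depend on `ε`. -/
lemma gradX_penalized_tikhonov (hI : IsInstance C f h) (a : Vec e) (ε ρ : ℝ) {x : Mat d r}
    {y : Vec e} (hx : x ∈ ballX d r C) (hy : y ∈ dom h) :
    gradX (penalized (tikhonov f h a ε) ρ) x y
      = gradA x (gradX f (AMap x) y) + (ρ / 2) • gradC x (cMap x) := by
  rw [gradX_penalized ρ (hI.differentiableAt_tikhonov_left a ε ⟨x, hx, rfl⟩ hy), gradX_tikhonov]

lemma gradY_penalized_tikhonov (hI : IsInstance C f h) (a : Vec e) (ε ρ : ℝ) {x : Mat d r}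
    {y : Vec e} (hx : x ∈ ballX d r C) (hy : y ∈ dom h) :
    gradY (penalized (tikhonov f h a ε) ρ) x y
      = gradY f (AMap x) y - (ε / (2 * Metric.diam (dom h))) • (y - a) := by
  rw [gradY_penalized, gradY_tikhonov h a ε (hI.differentiableAt_right ⟨x, hx, rfl⟩ hy)]

/-- Regularization increases the Lipschitz constant by its modulus at most. -/
lemma isPenLip_tikhonov (hI : IsInstance C f h) (a : Vec e) {ε ρ l : ℝ} (hε : 0 < ε)
    (hl : IsPenLip C f h ρ l) :
    IsPenLip C (tikhonov f h a ε) h ρ (l + ε / (2 * Metric.diam (dom h))) := by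
  intro x₁ hx₁ x₂ hx₂ y₁ hy₁ y₂ hy₂
  obtain ⟨h1, h2⟩ := hl x₁ hx₁ x₂ hx₂ y₁ hy₁ y₂ hy₂
  have hD := hI.diam_pos
  have hμ : 0 < ε / (2 * Metric.diam (dom h)) := by positivity
  rw [hI.gradX_penalized_tikhonov a ε ρ hx₁ hy₁, hI.gradX_penalized_tikhonov a ε ρ hx₂ hy₂,
    hI.gradY_penalized_tikhonov a ε ρ hx₁ hy₁, hI.gradY_penalized_tikhonov a ε ρ hx₂ hy₂]
  rw [gradX_penalized ρ (hI.differentiableAt_left ⟨x₁, hx₁, rfl⟩ hy₁),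
    gradX_penalized ρ (hI.differentiableAt_left ⟨x₂, hx₂, rfl⟩ hy₂)] at h1
  rw [gradY_penalized, gradY_penalized] at h2
  set μ := ε / (2 * Metric.diam (dom h))
  have hx0 := mul_nonneg hμ.le (norm_nonneg (x₁ - x₂))
  have hy0 := mul_nonneg hμ.le (norm_nonneg (y₁ - y₂))
  refine ⟨h1.trans (by linarith), ?_⟩
  have e1 : gradY f (AMap x₁) y₁ - μ • (y₁ - a) - (gradY f (AMap x₂) y₂ - μ • (y₂ - a))
      = (gradY f (AMap x₁) y₁ - gradY f (AMap x₂) y₂) - μ • (y₁ - y₂) := by module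
  rw [e1]
  refine (norm_sub_le _ _).trans ?_
  rw [norm_smul, Real.norm_of_nonneg hμ.le]
  linarith

/-- The partial gradient in `x` is bounded. -/
lemma exists_norm_gradX_le (hI : IsInstance C f h) :
    ∃ G : ℝ, 0 ≤ G ∧ ∀ x ∈ barX d r C, ∀ y ∈ dom h, ‖gradX f x y‖ ≤ G := by
  obtain ⟨Lxx, Lxy, Lyx, Lyy, h1, h2, -, -, hL⟩ := hI.smooth.2
  have hB := (isCompact_barX (d := d) (r := r) (C := C)).isBounded
  rcases (barX d r C).eq_empty_or_nonempty with hem | ⟨x₀, hx₀⟩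
  · exact ⟨0, le_rfl, by simp [hem]⟩
  obtain ⟨y₀, hy₀⟩ := hI.regularizer.nonempty_dom
  refine ⟨‖gradX f x₀ y₀‖ + (Lxx * Metric.diam (barX d r C) + Lxy * Metric.diam (dom h)),
    by positivity, fun x hx y hy => ?_⟩
  have h3 := (hL x hx x₀ hx₀ y hy y₀ hy₀).1
  have h4 := Metric.dist_le_diam_of_mem hB hx hx₀
  have h5 := dist_dom_le hI.regularizer hy hy₀
  rw [dist_eq_norm] at h4
  have h6 := norm_le_norm_add_norm_sub' (gradX f x y) (gradX f x₀ y₀)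
  refine h6.trans ?_
  gcongr
  exact h3.trans (by gcongr)

/-- The penalized function has a Lipschitz gradient. -/
lemma exists_isPenLip (hI : IsInstance C f h) (ρ : ℝ) : ∃ l > 0, IsPenLip C f h ρ l := by
  obtain ⟨Lxx, Lxy, Lyx, Lyy, h1, h2, h3, h4, hL⟩ := hI.smooth.2
  obtain ⟨G, hG, hGb⟩ := hI.exists_norm_gradX_le
  obtain ⟨LA, hLA, hA⟩ := exists_lipschitz_of_contDiff (contDiff_AMap (d := d) (r := r))
    (isBounded_ballX (C := C))
  have hsm : ContDiff ℝ 1 fun q : Mat d r × Mat d r =>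
      gradA q.1 q.2 + (ρ / 2) • gradC q.1 (cMap q.1) :=
    contDiff_gradA.add ((contDiff_gradC_cMap.comp contDiff_fst).const_smul (ρ / 2))
  obtain ⟨K, hK0, hK⟩ := exists_lipschitz_of_contDiff hsm
    ((isBounded_ballX (d := d) (r := r) (C := C)).prod (isBounded_ballX (C := G)))
  set l := 1 + (K * (1 + Lxx * LA + Lxy) + Lyx * LA + Lyy) with hl
  have hp : 0 ≤ K * Lxx * LA := by positivity
  have hp1 : 0 ≤ K * Lxy := by positivity
  have hp2 : 0 ≤ Lyx * LA := by positivity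
  refine ⟨l, by positivity, fun x₁ hx₁ x₂ hx₂ y₁ hy₁ y₂ hy₂ => ?_⟩
  have hb₁ : AMap x₁ ∈ barX d r C := ⟨x₁, hx₁, rfl⟩
  have hb₂ : AMap x₂ ∈ barX d r C := ⟨x₂, hx₂, rfl⟩
  obtain ⟨g1, g2⟩ := hL _ hb₁ _ hb₂ y₁ hy₁ y₂ hy₂
  have hA' := hA x₁ hx₁ x₂ hx₂
  rw [gradX_penalized ρ (hI.differentiableAt_left hb₁ hy₁),
    gradX_penalized ρ (hI.differentiableAt_left hb₂ hy₂), gradY_penalized, gradY_penalized]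
  have nx := norm_nonneg (x₁ - x₂)
  have ny := norm_nonneg (y₁ - y₂)
  have a1 : Lxx * ‖AMap x₁ - AMap x₂‖ ≤ Lxx * (LA * ‖x₁ - x₂‖) := by gcongr
  have a2 : Lyx * ‖AMap x₁ - AMap x₂‖ ≤ Lyx * (LA * ‖x₁ - x₂‖) := by gcongr
  constructor
  · have h5 := hK (x₁, gradX f (AMap x₁) y₁) ⟨hx₁, hGb _ hb₁ _ hy₁⟩
      (x₂, gradX f (AMap x₂) y₂) ⟨hx₂, hGb _ hb₂ _ hy₂⟩
    refine h5.trans ?_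
    have h6 : ‖((x₁, gradX f (AMap x₁) y₁) : Mat d r × Mat d r) - (x₂, gradX f (AMap x₂) y₂)‖
        ≤ ‖x₁ - x₂‖ + ‖gradX f (AMap x₁) y₁ - gradX f (AMap x₂) y₂‖ := by
      rw [Prod.mk_sub_mk, Prod.norm_mk]
      exact max_le_add_of_nonneg (norm_nonneg _) (norm_nonneg _)
    calc _ ≤ K * (‖x₁ - x₂‖ + (Lxx * (LA * ‖x₁ - x₂‖) + Lxy * ‖y₁ - y₂‖)) := by
          gcongr
          exact h6.trans (by linarith)
      _ = (K * (1 + Lxx * LA)) * ‖x₁ - x₂‖ + (K * Lxy) * ‖y₁ - y₂‖ := by ring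
      _ ≤ l * ‖x₁ - x₂‖ + l * ‖y₁ - y₂‖ := by
          gcongr <;> rw [hl] <;> linarith
  · calc _ ≤ (Lyx * LA) * ‖x₁ - x₂‖ + Lyy * ‖y₁ - y₂‖ := by linarith
      _ ≤ l * ‖x₁ - x₂‖ + l * ‖y₁ - y₂‖ := by
          gcongr <;> rw [hl] <;> linarith

/-- The Lipschitz constant dominates the modulus of strong concavity. -/
lemma modulus_le (hI : IsInstance C f h) (hC : 0 ≤ C) (a : Vec e) {ε ρ l : ℝ}
    (hl : IsPenLip C (tikhonov f h a ε) h ρ l) : ε / (2 * Metric.diam (dom h)) ≤ l := by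
  obtain ⟨y, hy, w, hw, hne⟩ := hI.nontrivial_dom
  have h0 : (0 : Mat d r) ∈ ballX d r C := by simpa [ballX] using hC
  have hx : AMap (0 : Mat d r) ∈ barX d r C := ⟨0, h0, rfl⟩
  have c1 := hI.tikhonov_le a ε hx hy hw
  have c2 := hI.tikhonov_le a ε hx hw hy
  have h2 := (hl 0 h0 0 h0 y hy w hw).2
  rw [gradY_penalized, gradY_penalized, sub_self, norm_zero, mul_zero, zero_add] at h2
  have hpos : 0 < ‖w - y‖ := norm_pos_iff.2 (sub_ne_zero.2 hne.symm)
  have h4 : ⟪gradY (tikhonov f h a ε) (AMap 0) y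
      - gradY (tikhonov f h a ε) (AMap 0) w, w - y⟫ ≤ (l * ‖y - w‖) * ‖w - y‖ := by
    refine (real_inner_le_norm _ _).trans ?_
    gcongr
  rw [norm_sub_rev y w] at c2 h4
  rw [inner_sub_left] at h4
  rw [← neg_sub w y, inner_neg_right] at c2
  by_contra! hlt
  nlinarith [mul_pos (sub_pos.2 hlt) (mul_pos hpos hpos)]

end IsInstance

end Instances

/-! ### The algorithm as a saddle point method -/

section Runs

open scoped RealInnerProductSpace

variable {d r e : ℕ} {C : ℝ} {f : Mat d r → Vec e → ℝ} {h : Vec e → EReal}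

lemma IsInstance.isSaddleProblem (hI : IsInstance C f h) (hC : 0 ≤ C) (a : Vec e) {ε ρ l : ℝ}
    (hε : 0 < ε) (hl0 : 0 < l) (hl : IsPenLip C (tikhonov f h a ε) h ρ l) :
    IsSaddleProblem (ballX d r C) (dom h) (penalized (tikhonov f h a ε) ρ)
      (gradX (penalized (tikhonov f h a ε) ρ)) (gradY (penalized (tikhonov f h a ε) ρ))
      (fun y => (h y).toReal) l (ε / (2 * Metric.diam (dom h))) where
  convex_X := convex_ballX
  isCompact_X := isCompact_ballX
  nonempty_X := ⟨0, by simpa [ballX] using hC⟩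
  isCompact_Y := hI.regularizer.isCompact_dom
  nonempty_Y := hI.regularizer.nonempty_dom
  continuousOn_g := by
    have hA : Continuous (AMap : Mat d r → Mat d r) := (contDiff_AMap (N := 1)).continuous
    have hc : Continuous (cMap : Mat d r → Mat r r) := (contDiff_cMap (N := 1)).continuous
    have h1 : ContinuousOn (fun q : Mat d r × Vec e => f (AMap q.1) q.2)
        (ballX d r C ×ˢ dom h) :=
      hI.continuousOn.comp (f := fun q : Mat d r × Vec e => (AMap q.1, q.2))
        (by fun_prop) fun q hq => ⟨⟨q.1, hq.1, rfl⟩, hq.2⟩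
    have h2 : Continuous fun q : Mat d r × Vec e =>
        ε / (4 * Metric.diam (dom h)) * ‖q.2 - a‖ ^ 2 := by fun_prop
    have h3 : Continuous fun q : Mat d r × Vec e => ρ / 4 * ‖cMap q.1‖ ^ 2 := by fun_prop
    exact (h1.sub h2.continuousOn).add h3.continuousOn
  continuousOn_H := hI.regularizer.continuousOn
  convexOn_H := hI.regularizer.convexOn
  l_pos := hl0
  μ_pos := by
    have := hI.diam_pos
    positivity
  lipschitz_gx := fun x₁ h₁ x₂ h₂ y₁ h₃ y₂ h₄ => (hl x₁ h₁ x₂ h₂ y₁ h₃ y₂ h₄).1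
  lipschitz_gy := fun x₁ h₁ x₂ h₂ y₁ h₃ y₂ h₄ => (hl x₁ h₁ x₂ h₂ y₁ h₃ y₂ h₄).2
  expand_x := fun x₁ h₁ x₂ h₂ y hy =>
    abs_expand_le (φ := fun x => penalized (tikhonov f h a ε) ρ x y)
      (φ' := fun x => gradX (penalized (tikhonov f h a ε) ρ) x y) convex_ballX
      (fun x hx => (hasGradientAt_penalized ρ (hI.differentiableAt_tikhonov_left a ε ⟨x, hx, rfl⟩
        hy)).differentiableAt.hasGradientAt)
      (fun x hx u hu => by simpa using (hl x hx u hu y hy y hy).1) h₁ h₂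
  concave := fun x hx y hy w hw => by
    have := hI.tikhonov_le a ε (x := AMap x) ⟨x, hx, rfl⟩ hy hw
    rw [gradY_penalized]
    unfold penalized
    linarith

lemma smoothed_eq (f : Mat d r → Vec e → ℝ) (H : Vec e → ℝ) (ρ l : ℝ) (x : Mat d r) (y : Vec e)
    (z : Mat d r) : smoothed f ρ (2 * l) x y z - H y = lag (penalized f ρ) H l x y z := by
  unfold smoothed lag
  ring

section Saddle

variable {F : Mat d r → Vec e → ℝ} {ρ l μ : ℝ}

/-- The dual function of the definition is the abstract one. -/
lemma dualFun_eq (hh : IsRegularizer h)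
    (P : IsSaddleProblem (ballX d r C) (dom h) (penalized F ρ) (gradX (penalized F ρ))
      (gradY (penalized F ρ)) (fun y => (h y).toReal) l μ) {y : Vec e} (hy : y ∈ dom h)
    (z : Mat d r) :
    dualFun C F h ρ (2 * l) y z
      = ((dualVal (ballX d r C) (penalized F ρ) (fun y => (h y).toReal) l y z : ℝ) : EReal) := by
  obtain ⟨hx, hmin⟩ := P.argX_spec hy z
  have e1 : (⨅ x ∈ ballX d r C, ((smoothed F ρ (2 * l) x y z : ℝ) : EReal))
      = ((smoothed F ρ (2 * l) (argX (ballX d r C) (penalized F ρ) (fun y => (h y).toReal) l y z)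
        y z : ℝ) : EReal) := by
    refine le_antisymm (iInf₂_le _ hx) (le_iInf₂ fun u hu => ?_)
    have := hmin u hu
    simp only [← smoothed_eq] at this
    exact_mod_cast (sub_le_sub_iff_right _).1 this
  rw [dualFun, e1, ← hh.coe_toReal hy, ← EReal.coe_sub, dualVal, ← smoothed_eq]

lemma dualFun_eq_bot {y : Vec e} (hy : y ∉ dom h) (ρ p : ℝ)
    (z : Mat d r) : dualFun C F h ρ p y z = ⊥ := by
  rw [dualFun, IsRegularizer.eq_top h hy, EReal.sub_top]

/-- The maximizer of the dual function is an admissible initial point. -/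
lemma isInit_argY (hh : IsRegularizer h)
    (P : IsSaddleProblem (ballX d r C) (dom h) (penalized F ρ) (gradX (penalized F ρ))
      (gradY (penalized F ρ)) (fun y => (h y).toReal) l μ) {z : Mat d r} (hz : z ∈ stiefel d r) :
    IsInit C F h ρ (2 * l) z
      (argY (ballX d r C) (dom h) (penalized F ρ) (fun y => (h y).toReal) l z) z := by
  obtain ⟨hy, hmax⟩ := P.argY_spec z
  refine ⟨hz, ⟨hy, fun w => ?_⟩, Or.inl rfl⟩
  by_cases hw : w ∈ dom h
  · rw [dualFun_eq hh P hw, dualFun_eq hh P hy]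
    exact_mod_cast hmax w hw
  · rw [dualFun_eq_bot hw]
    exact bot_le

lemma mem_ballX_of_isInit {p : ℝ} {x₀ z₀ : Mat d r} {y₀ : Vec e}
    (hM : stiefel d r ⊆ ballX d r C) (hi : IsInit C F h ρ p x₀ y₀ z₀) : x₀ ∈ ballX d r C := by
  rcases hi.2.2 with rfl | hx
  · exact hM hi.1
  · exact hx.1

/-- The initial value of the potential. -/
lemma potential_init_le (hh : IsRegularizer h)
    (P : IsSaddleProblem (ballX d r C) (dom h) (penalized F ρ) (gradX (penalized F ρ))
      (gradY (penalized F ρ)) (fun y => (h y).toReal) l μ) (hM : stiefel d r ⊆ ballX d r C)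
    {x₀ z₀ : Mat d r} {y₀ : Vec e} (hi : IsInit C F h ρ (2 * l) x₀ y₀ z₀) {m : ℝ}
    (hm : ∀ x ∈ stiefel d r, ∀ y ∈ dom h, F x y - (h y).toReal ≤ m) :
    potential (ballX d r C) (dom h) (penalized F ρ) (fun y => (h y).toReal) l x₀ y₀ z₀ ≤ m := by
  obtain ⟨hz, ⟨hy, hmax⟩, hx⟩ := hi
  have h1 := hmax (argY (ballX d r C) (dom h) (penalized F ρ) (fun y => (h y).toReal) l z₀)
  rw [dualFun_eq hh P (P.argY_spec z₀).1, dualFun_eq hh P hy, EReal.coe_le_coe_iff] at h1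
  have hz0 : ∀ y ∈ dom h, lag (penalized F ρ) (fun y => (h y).toReal) l z₀ y z₀ ≤ m := by
    intro y hy
    have := hm z₀ hz y hy
    simpa [lag, penalized, AMap_of_mem hz, cMap_of_mem hz] using this
  have h2 : lag (penalized F ρ) (fun y => (h y).toReal) l x₀ y₀ z₀ ≤ m := by
    rcases hx with rfl | ⟨hx, hmin⟩
    · exact hz0 y₀ hy
    · have h3 := hmin z₀ (hM hz)
      have h4 : primalFun F h ρ (2 * l) z₀ z₀ ≤ (m : EReal) := by
        refine iSup_le fun y => ?_
        by_cases hy : y ∈ dom h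
        · rw [← hh.coe_toReal hy, ← EReal.coe_sub, EReal.coe_le_coe_iff]
          have := hz0 y hy
          rwa [← smoothed_eq] at this
        · rw [IsRegularizer.eq_top h hy, EReal.sub_top]
          exact bot_le
      have h5 := (le_iSup (fun y => ((smoothed F ρ (2 * l) x₀ y z₀ : ℝ) : EReal) - h y) y₀).trans
        (h3.trans h4)
      rw [← hh.coe_toReal hy, ← EReal.coe_sub, EReal.coe_le_coe_iff] at h5
      rwa [← smoothed_eq]
  unfold potential
  linarith

end Saddle

/-- The dual step size. -/
lemma tau_two_eq {s l : ℝ} (hs : 0 < s) (hl : 0 < l) :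
    (1 / 16 * (3 / (s / l))⁻¹ : ℝ) = (48 * (l / s))⁻¹ := by
  field_simp
  norm_num

/-- The steps of a run, as variational inequalities. -/
lemma IsInstance.run_steps (hI : IsInstance C f h) (hM : stiefel d r ⊆ ballX d r C)
    {a : Vec e} {ε μ ρ l s α : ℝ} (hl0 : 0 < l) (hs : 0 < s)
    (hμl : μ ≤ l) {x : ℕ → Mat d r} {y : ℕ → Vec e} {z : ℕ → Mat d r}
    (hrun : IsRun C (tikhonov f h a ε) h μ ρ l s α x y z) :
    (∀ t, x t ∈ ballX d r C) ∧ (∀ t, y t ∈ dom h) ∧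
    (∀ t, ∀ u ∈ ballX d r C, 0 ≤ ⟪gradX (penalized (tikhonov f h a ε) ρ) (x t) (y t)
      + (2 * l) • (x t - z t) + (l / s) • (x (t + 1) - x t), u - x (t + 1)⟫) ∧
    (∀ t, ∀ w ∈ dom h, (h (y (t + 1))).toReal
      + ⟪gradY (penalized (tikhonov f h a ε) ρ) (x (t + 1)) (y t)
        - (48 * (l / s)) • (y (t + 1) - y t), w - y (t + 1)⟫ ≤ (h w).toReal) ∧
    ∀ t, z (t + 1) = z t + (α * μ / (48 * (l / s))) • (x (t + 1) - z t) := by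
  obtain ⟨hinit, hx, hy, hz⟩ := hrun
  rw [tau_two_eq hs hl0] at hy hz
  have hκ : 0 < l / s := by positivity
  have hτ : 0 < (48 * (l / s))⁻¹ := by positivity
  have hxm : ∀ t, x t ∈ ballX d r C := by
    intro t
    cases t with
    | zero => exact mem_ballX_of_isInit hM hinit
    | succ t => exact (hx t).1
  have hym : ∀ t, y t ∈ dom h := by
    intro t
    cases t with
    | zero => exact hinit.2.1.1
    | succ t => exact hI.regularizer.mem_dom_of_isProx hτ (hy t)
  refine ⟨hxm, hym, fun t u hu => ?_, fun t w hw => ?_, fun t => ?_⟩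
  · have h1 := inner_le_zero_of_isProj convex_ballX (hx t) u hu
    rw [gradX_tikhonov, ← hI.gradX_penalized_tikhonov a ε ρ (hxm t) (hym t)] at h1
    set G := gradX (penalized (tikhonov f h a ε) ρ) (x t) (y t)
    have e1 : G + (2 * l) • (x t - z t) + (l / s) • (x (t + 1) - x t)
        = (-(l / s)) • (x t - (s / l) • (G + (2 * l) • (x t - z t)) - x (t + 1)) := by
      have : (l / s) * (s / l) = 1 := by field_simp
      linear_combination (norm := module) (-this) • (G + (2 * l) • (x t - z t))
    rw [e1, inner_smul_left, conj_trivial]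
    nlinarith
  · have h1 := hI.regularizer.le_of_isProx hτ (hy t) hw
    rw [gradY_penalized]
    set g := gradY (tikhonov f h a ε) (AMap (x (t + 1))) (y t)
    have e1 : g - (48 * (l / s)) • (y (t + 1) - y t)
        = (48 * (l / s))⁻¹⁻¹ • (y t + (48 * (l / s))⁻¹ • (g - (0 : ℝ) • y t) - y (t + 1)) := by
      have : (48 * (l / s)) * (48 * (l / s))⁻¹ = 1 := mul_inv_cancel₀ (by positivity)
      rw [inv_inv]
      linear_combination (norm := module) (-this) • g
    rwa [e1]
  · rw [hz t, min_eq_left hμl, div_eq_mul_inv (α * μ)]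

/-- Runs exist. -/
lemma exists_run {F : Mat d r → Vec e → ℝ} (hh : IsRegularizer h) (hne : (ballX d r C).Nonempty)
    {μ ρ l s α : ℝ} (hl0 : 0 < l) (hs : 0 < s) {z₀ : Mat d r} {y₀ : Vec e}
    (hi : IsInit C F h ρ (2 * l) z₀ y₀ z₀) :
    ∃ x y z, z 0 = z₀ ∧ IsRun C F h μ ρ l s α x y z := by
  have hproj : ∀ u : Mat d r, ∃ p, IsProj (ballX d r C) u p := by
    intro u
    obtain ⟨p, hp, hmin⟩ := isCompact_ballX.exists_isMinOn hne
      (f := fun p => ‖u - p‖) (by fun_prop)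
    exact ⟨p, hp, fun q hq => hmin hq⟩
  choose px hpx using hproj
  have hτ : 0 < (1 / 16 * (3 / (s / l))⁻¹ : ℝ) := by positivity
  choose py hpy using hh.exists_isProx hτ
  let nx : Mat d r × Vec e × Mat d r → Mat d r := fun q =>
    px (q.1 - (s / l) • ((gradA q.1 (gradX F (AMap q.1) q.2.1)
      + (ρ / 2) • gradC q.1 (cMap q.1)) + (2 * l) • (q.1 - q.2.2)))
  let step : Mat d r × Vec e × Mat d r → Mat d r × Vec e × Mat d r := fun q =>
    (nx q, py (q.2.1 + (1 / 16 * (3 / (s / l))⁻¹ : ℝ) •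
      (gradY F (AMap (nx q)) q.2.1 - (0 : ℝ) • q.2.1)),
      q.2.2 + (α * min μ l * (1 / 16 * (3 / (s / l))⁻¹)) • (nx q - q.2.2))
  let it : ℕ → Mat d r × Vec e × Mat d r := fun t => step^[t] (z₀, y₀, z₀)
  have hit : ∀ t, it (t + 1) = step (it t) := fun t => Function.iterate_succ_apply' _ _ _
  refine ⟨fun t => (it t).1, fun t => (it t).2.1, fun t => (it t).2.2, rfl, hi, ?_, ?_, ?_⟩
  · intro t
    simp only [hit]
    exact hpx _
  · intro t
    simp only [hit]
    exact hpy _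
  · intro t
    simp only [hit, step]

lemma eq_zero_of_inner_nonneg {E : Type*} [NormedAddCommGroup E] [InnerProductSpace ℝ E]
    {v p : E} {C : ℝ} (hp : ‖p‖ < C) (hv : ∀ u : E, ‖u‖ ≤ C → 0 ≤ ⟪v, u - p⟫) : v = 0 := by
  have hpos : 0 < (C - ‖p‖) / (‖v‖ + 1) := div_pos (by linarith) (by positivity)
  have h1 := hv (p - ((C - ‖p‖) / (‖v‖ + 1)) • v) (by
    refine (norm_sub_le _ _).trans ?_
    rw [norm_smul, Real.norm_of_nonneg hpos.le]
    have : (C - ‖p‖) / (‖v‖ + 1) * ‖v‖ ≤ C - ‖p‖ := by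
      rw [div_mul_eq_mul_div, div_le_iff₀ (by positivity)]
      nlinarith [norm_nonneg v]
    linarith)
  rw [sub_sub_cancel_left, inner_neg_right, inner_smul_right, real_inner_self_eq_norm_sq] at h1
  have h2 : ‖v‖ ^ 2 ≤ 0 := by
    by_contra! h
    nlinarith [mul_pos hpos h]
  exact norm_eq_zero.1 (pow_eq_zero_iff two_ne_zero |>.1 (le_antisymm h2 (sq_nonneg _)))

end Runs

/-! ### Complexity -/

section Complexity

open scoped RealInnerProductSpace

variable {d r e : ℕ} {C : ℝ} {f : Mat d r → Vec e → ℝ} {h : Vec e → EReal}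

lemma stiefel_subset_ballX (hC : sSup ((fun x => ‖x‖) '' stiefel d r) ≤ C) :
    stiefel d r ⊆ ballX d r C := fun _ hx => (norm_le_sSup hx).trans hC

lemma IsInstance.exists_bound (hI : IsInstance C f h) :
    ∃ M > 0, ∀ x ∈ barX d r C, ∀ y ∈ dom h, |f x y - (h y).toReal| ≤ M := by
  have hH : ContinuousOn (fun q : Mat d r × Vec e => (h q.2).toReal) (barX d r C ×ˢ dom h) :=
    hI.regularizer.continuousOn.comp (f := fun q : Mat d r × Vec e => q.2) (by fun_prop)
      fun q hq => hq.2
  obtain ⟨M, hM⟩ := (isCompact_barX.prod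
    hI.regularizer.isCompact_dom).exists_bound_of_continuousOn (hI.continuousOn.sub hH)
  exact ⟨max M 1, by positivity, fun x hx y hy => (hM (x, y) ⟨hx, hy⟩).trans (le_max_left _ _)⟩

/-- Near the manifold, approximate stationarity of the penalized regularized problem gives
approximate stationarity of the original problem at the projection. -/
lemma IsInstance.exists_stationarity_const (hI : IsInstance C f h)
    (hC : 1 / 2 + sSup ((fun x => ‖x‖) '' stiefel d r) < C) :
    ∃ N > 0, ∃ ρ₀ > 0, ∀ ρ ≥ ρ₀, ∀ ε > 0, ∀ a ∈ dom h, ∀ x ∈ ballX d r C, ∀ y ∈ dom h,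
      ∀ v ∈ subdiff h y, ∀ δ : ℝ, ‖cMap x‖ ≤ 1 / 2 →
      ‖gradX (penalized (tikhonov f h a ε) ρ) x y‖ ≤ δ →
      ‖v - gradY (penalized (tikhonov f h a ε) ρ) x y‖ ≤ δ → 2 * N * δ ≤ ε →
      ∃ q, (∀ q', IsProj (stiefel d r) x q' ↔ q' = q) ∧ ‖x - q‖ ≤ 3 / ρ * ε ∧
        IsEpsStationary f h ε q y := by
  obtain ⟨Lxx, Lxy, Lyx, Lyy, l1, -, l3, -, hL⟩ := hI.smooth.2
  obtain ⟨G, hG, hGb⟩ := hI.exists_norm_gradX_le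
  obtain ⟨LA, hLA, hA⟩ := exists_lipschitz_of_contDiff (contDiff_AMap (d := d) (r := r))
    (isBounded_ballX (C := C))
  obtain ⟨LT, hLT, hT⟩ := exists_lipschitz_of_contDiff (contDiff_tangent (d := d) (r := r))
    ((isBounded_ballX (d := d) (r := r) (C := C)).prod (isBounded_ballX (C := G)))
  have hsup : 0 ≤ sSup ((fun x : Mat d r => ‖x‖) '' stiefel d r) :=
    Real.sSup_nonneg (by rintro _ ⟨x, -, rfl⟩; exact norm_nonneg x)
  have hC0 : 0 < C := by linarith
  have hM := stiefel_subset_ballX (d := d) (r := r) (C := C) (by linarith)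
  set B := G / 2 + LT * (1 + Lxx * LA) with hB
  have hB0 : 0 ≤ B := by positivity
  refine ⟨1 + 4 * C + 4 * C ^ 2 + 4 * C * B + 4 * C * (Lyx * LA), by positivity,
    1 + 6 * C * G, by positivity, fun ρ hρ ε hε a ha x hx y hy v hv δ hc hgx hgy hδ => ?_⟩
  have hCG : 0 ≤ C * G := by positivity
  have hρ1 : 1 ≤ ρ := by linarith
  have hρ0 : 0 < ρ := by linarith
  have hδ0 : 0 ≤ δ := (norm_nonneg _).trans hgx
  obtain ⟨q, hq, huniq, hdist⟩ := exists_unique_proj (x := x) (by linarith)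
  have hxb : AMap x ∈ barX d r C := ⟨x, hx, rfl⟩
  have hqb : q ∈ barX d r C := ⟨q, hM hq, AMap_of_mem hq⟩
  have hw := hI.gradX_penalized_tikhonov a ε ρ hx hy
  have hu := hGb _ hxb y hy
  have hc1 := norm_cMap_le hx hu hc (by linarith) hρ0.le hw
  have ht := norm_tangent_le hx hu hρ0.le hw
  set w := gradX (penalized (tikhonov f h a ε) ρ) x y
  have hCw : C * ‖w‖ ≤ C * δ := by gcongr
  have hcδ : ρ * ‖cMap x‖ ≤ 4 * C * δ := by linarith
  have hcδ' : ‖cMap x‖ ≤ 4 * C * δ := by nlinarith [norm_nonneg (cMap x)]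
  have hCδ := mul_nonneg hC0.le hδ0
  have hC2δ := mul_nonneg hC0.le hCδ
  have hCBδ := mul_nonneg hB0 hCδ
  have hLδ := mul_nonneg (mul_nonneg l3 hLA) hCδ
  have hAq : ‖AMap x - q‖ ≤ LA * ‖cMap x‖ := by
    have := hA x hx q (hM hq)
    rw [AMap_of_mem hq] at this
    exact this.trans (by gcongr)
  obtain ⟨g1, g2⟩ := hL _ hxb _ hqb y hy y hy
  rw [sub_self, norm_zero, mul_zero, add_zero] at g1 g2
  have g1' : Lxx * ‖AMap x - q‖ ≤ Lxx * (LA * ‖cMap x‖) := by gcongr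
  have g2' : Lyx * ‖AMap x - q‖ ≤ Lyx * (LA * ‖cMap x‖) := by gcongr
  refine ⟨q, huniq, ?_, hq, hy, ?_, ?_⟩
  · refine hdist.trans ?_
    rw [div_mul_eq_mul_div, le_div_iff₀ hρ0]
    linarith
  · have h1 := hT (q, gradX f q y) ⟨hM hq, hGb _ hqb _ hy⟩ (x, gradX f (AMap x) y) ⟨hx, hu⟩
    have h2 : ‖((q, gradX f q y) : Mat d r × Mat d r) - (x, gradX f (AMap x) y)‖
        ≤ ‖x - q‖ + ‖gradX f (AMap x) y - gradX f q y‖ := by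
      rw [Prod.mk_sub_mk, Prod.norm_mk, norm_sub_rev q, norm_sub_rev (gradX f q y)]
      exact max_le_add_of_nonneg (norm_nonneg _) (norm_nonneg _)
    have h3 : ‖tangent q (gradX f q y) - tangent x (gradX f (AMap x) y)‖
        ≤ LT * (1 + Lxx * LA) * ‖cMap x‖ := by
      refine h1.trans ?_
      rw [mul_assoc]
      gcongr
      linarith
    have h4 := norm_le_norm_add_norm_sub' (tangent q (gradX f q y))
      (tangent x (gradX f (AMap x) y))
    have h5 : B * ‖cMap x‖ ≤ B * (4 * C * δ) := by gcongr
    have h6 : C * (ρ * ‖cMap x‖) ≤ C * (4 * C * δ) := by gcongr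
    change ‖tangent q (gradX f q y)‖ ≤ ε
    rw [hB] at h5 hCBδ hδ
    linarith
  · have hv' : -gradY f q y + v ∈ dualResidual f h q y := ⟨v, hv, rfl⟩
    refine (Metric.infEDist_le_edist_of_mem hv').trans ?_
    rw [edist_dist, dist_zero_left]
    refine ENNReal.ofReal_le_ofReal ?_
    rw [hI.gradY_penalized_tikhonov a ε ρ hx hy] at hgy
    have hD := hI.diam_pos
    have e1 : -gradY f q y + v
        = (v - (gradY f (AMap x) y - (ε / (2 * Metric.diam (dom h))) • (y - a)))
          + (gradY f (AMap x) y - gradY f q y)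
          - (ε / (2 * Metric.diam (dom h))) • (y - a) := by abel
    have h1 : ‖(ε / (2 * Metric.diam (dom h))) • (y - a)‖ ≤ ε / 2 := by
      rw [norm_smul, Real.norm_of_nonneg (by positivity)]
      calc _ ≤ ε / (2 * Metric.diam (dom h)) * Metric.diam (dom h) := by
            gcongr
            exact dist_dom_le hI.regularizer hy ha
        _ = ε / 2 := by field_simp
    rw [e1]
    have h2 := norm_sub_le ((v - (gradY f (AMap x) y - (ε / (2 * Metric.diam (dom h))) • (y - a)))
          + (gradY f (AMap x) y - gradY f q y)) ((ε / (2 * Metric.diam (dom h))) • (y - a))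
    have h3 := norm_add_le (v - (gradY f (AMap x) y - (ε / (2 * Metric.diam (dom h))) • (y - a)))
      (gradY f (AMap x) y - gradY f q y)
    have h4 : (Lyx * LA) * ‖cMap x‖ ≤ (Lyx * LA) * (4 * C * δ) := by gcongr
    linarith

/-- The residual of a step in terms of its decrement of the potential. -/
lemma residual_sq_le {κ l β a b c m : ℝ} (hκ : 0 < κ) (hl : 0 < l) (hβ : 0 < β)
    (h : κ / 8 * a ^ 2 + κ * b ^ 2 + l * β / 2 * c ^ 2 ≤ m) :
    (2 * κ * a + 49 * κ * b + 2 * l * c) ^ 2 ≤ 3 * (2433 * κ + 8 * l / β) * m := by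
  have h1 : (2 * κ * a + 49 * κ * b + 2 * l * c) ^ 2
      ≤ 3 * (4 * κ ^ 2 * a ^ 2 + 2401 * κ ^ 2 * b ^ 2 + 4 * l ^ 2 * c ^ 2) := by
    linear_combination (sq_nonneg (2 * κ * a - 49 * κ * b)) + (sq_nonneg (2 * κ * a - 2 * l * c))
      + (sq_nonneg (49 * κ * b - 2 * l * c))
  have e1 : 4 * l ^ 2 * c ^ 2 = 8 * l / β * (l * β / 2 * c ^ 2) := by
    field_simp
    ring
  have hA : 0 ≤ κ / 8 * a ^ 2 := by positivity
  have hB : 0 ≤ κ * b ^ 2 := by positivity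
  have hC : 0 ≤ l * β / 2 * c ^ 2 := by positivity
  have hq : 0 ≤ 8 * l / β := by positivity
  have h2 : (2433 * κ + 8 * l / β) * (κ / 8 * a ^ 2 + κ * b ^ 2 + l * β / 2 * c ^ 2)
      ≤ (2433 * κ + 8 * l / β) * m := by gcongr
  have h3 : 4 * κ ^ 2 * a ^ 2 + 2401 * κ ^ 2 * b ^ 2 + 4 * l ^ 2 * c ^ 2
      ≤ (2433 * κ + 8 * l / β) * (κ / 8 * a ^ 2 + κ * b ^ 2 + l * β / 2 * c ^ 2) := by
    rw [e1]
    nlinarith [mul_nonneg hq hA, mul_nonneg hq hB, mul_nonneg hκ.le hA, mul_nonneg hκ.le hB,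
      mul_nonneg hκ.le hC]
  linarith

/-- The number of iterations that makes the residual small. -/
lemma residual_le_of_iterations {l s α ε D M δ K : ℝ} {T : ℕ} (hl : 0 < l) (hs : 0 < s)
    (hα : 0 < α) (hα1 : α ≤ 1) (hε : 0 < ε) (hD : 0 < D) (hM : 0 < M) (hδ : 0 < δ)
    (hμl : ε / (2 * D) ≤ l) (hK : 67608 * D * M / (s * α * δ ^ 2) ≤ K)
    (hT : K * l ^ 2 / (2 * ε ^ 3) ≤ T) :
    3 * (2433 * (l / s) + 8 * l / (α * (ε / (2 * D)) / (48 * (l / s)))) * (2 * M / T)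
      ≤ (δ * ε) ^ 2 := by
  have hμ : 0 < ε / (2 * D) := by positivity
  have hK0 : 0 < K := lt_of_lt_of_le (by positivity) hK
  have hT0 : 0 < (T : ℝ) := lt_of_lt_of_le (by positivity) hT
  have h1 : l / s ≤ 2 * D * l ^ 2 / (s * α * ε) := by
    rw [div_le_div_iff₀ hs (by positivity)]
    rw [div_le_iff₀ (by positivity)] at hμl
    have : α * ε ≤ 1 * (l * (2 * D)) := by gcongr
    nlinarith [mul_le_mul_of_nonneg_left this (mul_pos hl hs).le]
  have h2 : 8 * l / (α * (ε / (2 * D)) / (48 * (l / s))) = 384 * (2 * D * l ^ 2 / (s * α * ε)) := by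
    field_simp
    norm_num
  rw [h2]
  calc _ ≤ 3 * (2433 * (2 * D * l ^ 2 / (s * α * ε)) + 384 * (2 * D * l ^ 2 / (s * α * ε)))
        * (2 * M / (K * l ^ 2 / (2 * ε ^ 3))) := by gcongr
    _ = 67608 * D * M / (s * α * δ ^ 2) * ((δ * ε) ^ 2 / K) := by
      field_simp
      norm_num
    _ ≤ K * ((δ * ε) ^ 2 / K) := by gcongr
    _ = (δ * ε) ^ 2 := by field_simp

/-- The complexity bound. -/
theorem IsInstance.complexity (hI : IsInstance C f h)
    (hC : 1 / 2 + sSup ((fun x => ‖x‖) '' stiefel d r) < C) {a : Vec e} (ha : a ∈ dom h)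
    {ε₀ : ℝ} (hε₀ : 0 < ε₀) :
    ∃ ρbar > 0, ∀ s : ℝ, 0 < s → s ≤ 1 / 3 → ∀ α : ℝ, 0 < α → α < 1 / 2306 → ∃ K > 0,
      ∀ ρ ≥ ρbar, ∀ ε : ℝ, 0 < ε → ε ≤ ε₀ →
      ∀ l > 0, IsPenLip C (tikhonov f h a ε) h ρ l → ∀ x y z,
        IsRun C (tikhonov f h a ε) h (ε / (2 * Metric.diam (dom h))) ρ l s α x y z →
        ∃ t : ℕ, (t : ℝ) ≤ K * l ^ 2 / ε ^ 3 ∧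
          ∃ q, (∀ q', IsProj (stiefel d r) (x t) q' ↔ q' = q) ∧
            ‖x t - q‖ ≤ 3 / ρ * ε ∧ IsEpsStationary f h ε q (y t) := by
  obtain ⟨N, hN, ρ₀, hρ₀, hstat⟩ := hI.exists_stationarity_const hC
  obtain ⟨M₀, hM₀, hMb⟩ := hI.exists_bound
  have hD := hI.diam_pos
  set D := Metric.diam (dom h) with hDdef
  have hsup : 0 ≤ sSup ((fun x : Mat d r => ‖x‖) '' stiefel d r) :=
    Real.sSup_nonneg (by rintro _ ⟨x, -, rfl⟩; exact norm_nonneg x)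
  have hC0 : 0 < C := by linarith
  have hM := stiefel_subset_ballX (d := d) (r := r) (C := C) (by linarith)
  set M := M₀ + ε₀ * D / 4 with hMdef
  have hM0 : 0 < M := by positivity
  refine ⟨ρ₀ + 32 * M, by positivity, fun s hs hs3 α hα hα1 => ?_⟩
  set δ := 1 / (2 * N) with hδdef
  have hδ : 0 < δ := by positivity
  refine ⟨67608 * D * M / (s * α * δ ^ 2) + 4 * D ^ 2 * ε₀, by positivity, ?_⟩
  intro ρ hρ ε hε hεε₀ l hl hlip x y z hrun
  have hρ0 : 0 < ρ := by linarith
  set K := 67608 * D * M / (s * α * δ ^ 2) + 4 * D ^ 2 * ε₀ with hK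
  have hμl : ε / (2 * D) ≤ l := hI.modulus_le hC0.le a hlip
  have hμ : 0 < ε / (2 * D) := by positivity
  have P := hI.isSaddleProblem hC0.le a hε hl hlip
  obtain ⟨hxm, hym, hxs, hys, hzs⟩ := hI.run_steps hM hl hs hμl hrun
  -- the regularized function is bounded
  have hb : ∀ x ∈ barX d r C, ∀ y ∈ dom h, |tikhonov f h a ε x y - (h y).toReal| ≤ M := by
    intro x hx y hy
    have h1 := hMb x hx y hy
    have h2 : ε / (4 * D) * ‖y - a‖ ^ 2 ≤ ε₀ * D / 4 := by
      calc _ ≤ ε₀ / (4 * D) * D ^ 2 := by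
            gcongr
            exact dist_dom_le hI.regularizer hy ha
        _ = ε₀ * D / 4 := by field_simp
    have h3 : 0 ≤ ε / (4 * D) * ‖y - a‖ ^ 2 := by positivity
    unfold tikhonov
    rw [abs_le] at h1 ⊢
    constructor <;> linarith [h1.1, h1.2]
  have hlow : ∀ x ∈ ballX d r C, ∀ y ∈ dom h, ∀ z,
      -M + ρ / 4 * ‖cMap x‖ ^ 2
        ≤ lag (penalized (tikhonov f h a ε) ρ) (fun y => (h y).toReal) l x y z := by
    intro x hx y hy z
    have h1 := (abs_le.1 (hb (AMap x) ⟨x, hx, rfl⟩ y hy)).1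
    have h2 : 0 ≤ l * ‖x - z‖ ^ 2 := by positivity
    unfold lag penalized
    linarith
  set κ := l / s with hκdef
  have hκ : 3 * l ≤ κ := by
    rw [hκdef, le_div_iff₀ hs]
    nlinarith
  have hκ0 : 0 < κ := by positivity
  set V := fun t => potential (ballX d r C) (dom h) (penalized (tikhonov f h a ε) ρ)
    (fun y => (h y).toReal) l (x t) (y t) (z t) with hVdef
  have hdesc : ∀ t, V (t + 1) + (κ / 8 * ‖x (t + 1) - x t‖ ^ 2 + κ * ‖y (t + 1) - y t‖ ^ 2
      + l * (α * (ε / (2 * D)) / (48 * κ)) / 2 * ‖x (t + 1) - z t‖ ^ 2) ≤ V t := by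
    intro t
    have := P.potential_descent hκ hμl hα hα1 rfl (hxm t) (hxm (t + 1)) (hym t) (hym (t + 1))
      (hxs t) (hys t) (hzs t)
    linarith
  have hV0 : V 0 ≤ M := potential_init_le hI.regularizer P hM hrun.1
    fun x hx y hy => (abs_le.1 (hb x ⟨x, hM hx, AMap_of_mem hx⟩ y hy)).2
  have hVlow : ∀ t, -M ≤ V t := fun t => P.le_potential (hxm t) (hym t)
    fun u hu v hv => by
      have := hlow u hu v hv (z t)
      have h2 : 0 ≤ ρ / 4 * ‖cMap u‖ ^ 2 := by positivity
      linarith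
  have hVle : ∀ t, V t ≤ M := by
    have hanti : Antitone V := antitone_nat_of_succ_le fun t => by
      have := hdesc t
      have h2 : 0 ≤ κ / 8 * ‖x (t + 1) - x t‖ ^ 2 + κ * ‖y (t + 1) - y t‖ ^ 2
        + l * (α * (ε / (2 * D)) / (48 * κ)) / 2 * ‖x (t + 1) - z t‖ ^ 2 := by positivity
      linarith
    exact fun t => (hanti (Nat.zero_le t)).trans hV0
  have hc : ∀ t, ‖cMap (x t)‖ ≤ 1 / 2 := by
    intro t
    have h1 := hlow _ (hxm t) _ (hym t) (z t)
    have h2 := P.lag_le_potential (x t) (hym t) (z t)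
    have h3 := hVle t
    have h4 : ρ * ‖cMap (x t)‖ ^ 2 ≤ ρ * (1 / 2) ^ 2 := by
      simp only [hVdef] at h3
      linarith
    exact (sq_le_sq₀ (norm_nonneg _) (by norm_num)).1 (le_of_mul_le_mul_left h4 hρ0)
  -- the number of iterations
  have hK0 : 67608 * D * M / (s * α * δ ^ 2) ≤ K := by
    rw [hK]
    exact le_add_of_nonneg_right (by positivity)
  have hbig : 1 ≤ K * l ^ 2 / ε ^ 3 := by
    rw [le_div_iff₀ (by positivity), one_mul]
    calc ε ^ 3 = 4 * D ^ 2 * ε * (ε / (2 * D)) ^ 2 := by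
          field_simp
          norm_num
      _ ≤ 4 * D ^ 2 * ε₀ * l ^ 2 := by gcongr
      _ ≤ K * l ^ 2 := by
          gcongr
          rw [hK]
          exact le_add_of_nonneg_left (by positivity)
  set T := ⌊K * l ^ 2 / ε ^ 3⌋₊ with hTdef
  have hT0 : 0 < T := Nat.floor_pos.2 hbig
  have hTle : (T : ℝ) ≤ K * l ^ 2 / ε ^ 3 := Nat.floor_le (by linarith)
  have hTge : K * l ^ 2 / (2 * ε ^ 3) ≤ T := by
    have h1 := Nat.lt_floor_add_one (K * l ^ 2 / ε ^ 3)
    have h2 : (1 : ℝ) ≤ T := by exact_mod_cast hT0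
    have h3 : K * l ^ 2 / (2 * ε ^ 3) = K * l ^ 2 / ε ^ 3 / 2 := by
      field_simp
    rw [h3]
    linarith
  obtain ⟨t, htT, hta⟩ := exists_decrement_le hdesc hVlow hT0
  have hta' := hta.trans (show (V 0 - -M) / T ≤ 2 * M / T by
    gcongr
    linarith)
  have hres := (residual_sq_le hκ0 hl (by positivity) hta').trans
    (residual_le_of_iterations hl hs hα (by linarith) hε hD hM0 hδ hμl hK0 hTge)
  have hres' : 2 * κ * ‖x (t + 1) - x t‖ + 49 * κ * ‖y (t + 1) - y t‖
      + 2 * l * ‖x (t + 1) - z t‖ ≤ δ * ε :=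
    (sq_le_sq₀ (by positivity) (by positivity)).1 hres
  refine ⟨t + 1, le_trans (by exact_mod_cast htT) hTle, ?_⟩
  have hlx := hlip _ (hxm t) _ (hxm (t + 1)) _ (hym t) _ (hym (t + 1))
  have hly := hlip _ (hxm (t + 1)) _ (hxm (t + 1)) _ (hym t) _ (hym (t + 1))
  have nx := norm_nonneg (x (t + 1) - x t)
  have ny := norm_nonneg (y (t + 1) - y t)
  have nz := norm_nonneg (x (t + 1) - z t)
  have hlx' := mul_le_mul_of_nonneg_right hκ nx
  have hly' := mul_le_mul_of_nonneg_right hκ ny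
  rw [norm_sub_rev (x t), norm_sub_rev (y t)] at hlx
  rw [norm_sub_rev (y t), sub_self, norm_zero, mul_zero, zero_add] at hly
  have hκy := mul_nonneg hκ0.le ny
  have hκx := mul_nonneg hκ0.le nx
  have hlz := mul_nonneg hl.le nz
  have hly0 := mul_nonneg hl.le ny
  -- the projection onto the ball is inactive
  have hint : ‖x (t + 1)‖ < C := by
    obtain ⟨q, hq, -, hdist⟩ := exists_unique_proj (x := x (t + 1)) (by linarith [hc (t + 1)])
    have h1 := norm_le_norm_add_norm_sub' (x (t + 1)) q
    linarith [norm_le_sSup hq, hc (t + 1)]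
  have hzero := eq_zero_of_inner_nonneg hint fun u hu => hxs t u hu
  refine hstat ρ (by linarith) ε hε a ha (x (t + 1)) (hxm _) (y (t + 1)) (hym _) _
    (hI.regularizer.mem_subdiff (hym _) (hys t)) (δ * ε) (hc _) ?_ ?_ ?_
  · set g := gradX (penalized (tikhonov f h a ε) ρ) (x t) (y t)
    set g' := gradX (penalized (tikhonov f h a ε) ρ) (x (t + 1)) (y (t + 1))
    have e1 : g' = -(g - g') - (2 * l) • (x (t + 1) - z t)
        - (κ - 2 * l) • (x (t + 1) - x t) := by
      linear_combination (norm := module) hzero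
    rw [e1]
    have n1 := norm_sub_le (-(g - g') - (2 * l) • (x (t + 1) - z t))
      ((κ - 2 * l) • (x (t + 1) - x t))
    have n2 := norm_sub_le (-(g - g')) ((2 * l) • (x (t + 1) - z t))
    rw [norm_smul, Real.norm_of_nonneg (by linarith)] at n1
    rw [norm_neg, norm_smul, Real.norm_of_nonneg (by positivity)] at n2
    linarith [hlx.1, mul_nonneg hl.le nx]
  · set g := gradY (penalized (tikhonov f h a ε) ρ) (x (t + 1)) (y t)
    set g' := gradY (penalized (tikhonov f h a ε) ρ) (x (t + 1)) (y (t + 1))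
    have e1 : g - (48 * κ) • (y (t + 1) - y t) - g' = (g - g') - (48 * κ) • (y (t + 1) - y t) := by
      abel
    rw [e1]
    have n1 := norm_sub_le (g - g') ((48 * κ) • (y (t + 1) - y t))
    rw [norm_smul, Real.norm_of_nonneg (by positivity)] at n1
    linarith [hly.2]
  · rw [hδdef]
    field_simp
    rfl

end Complexity

/-! ### Regularization loses asymptotic stationarity -/

section Counterexample

open scoped RealInnerProductSpace

variable {d r e : ℕ}

/-- The indicator function of the unit ball. -/
def ballIndicator (e : ℕ) (y : Vec e) : EReal :=
  open Classical in if ‖y‖ ≤ 1 then 0 else ⊤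

/-- The coupling function `-‖y‖² / 2`. -/
def negHalfSq (d r e : ℕ) (_ : Mat d r) (y : Vec e) : ℝ := -(1 / 2) * ‖y‖ ^ 2

lemma ballIndicator_of_le {y : Vec e} (hy : ‖y‖ ≤ 1) : ballIndicator e y = 0 := if_pos hy

lemma ballIndicator_of_not_le {y : Vec e} (hy : ¬‖y‖ ≤ 1) : ballIndicator e y = ⊤ := if_neg hy

lemma dom_ballIndicator : dom (ballIndicator e) = Metric.closedBall 0 1 := by
  ext y
  rw [mem_closedBall_zero_iff]
  by_cases hy : ‖y‖ ≤ 1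
  · simp [dom, ballIndicator_of_le hy, hy]
  · simp [dom, ballIndicator_of_not_le hy, hy]

lemma isRegularizer_ballIndicator : IsRegularizer (ballIndicator e) where
  ne_bot y := by
    by_cases hy : ‖y‖ ≤ 1
    · simp [ballIndicator_of_le hy]
    · simp [ballIndicator_of_not_le hy]
  nonempty_dom := by
    rw [dom_ballIndicator]
    exact ⟨0, by simp⟩
  lsc := by
    refine lowerSemicontinuous_iff_isClosed_preimage.2 fun t => ?_
    rcases lt_or_ge t 0 with ht | ht
    · convert isClosed_empty
      ext y
      by_cases hy : ‖y‖ ≤ 1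
      · simp [ballIndicator_of_le hy, ht]
      · simp [ballIndicator_of_not_le hy, (ht.trans EReal.zero_lt_top).ne]
    · rcases eq_or_ne t ⊤ with rfl | ht'
      · simp
      · suffices h : ballIndicator e ⁻¹' Set.Iic t = Metric.closedBall 0 1 by
          rw [h]
          exact Metric.isClosed_closedBall
        ext y
        rw [mem_closedBall_zero_iff]
        by_cases hy : ‖y‖ ≤ 1
        · simp [ballIndicator_of_le hy, ht, hy]
        · simp [ballIndicator_of_not_le hy, ht', hy]
  convex_epigraph := by
    have h1 : {q : Vec e × ℝ | ballIndicator e q.1 ≤ (q.2 : EReal)}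
        = Metric.closedBall 0 1 ×ˢ Set.Ici 0 := by
      ext q
      rw [Set.mem_prod, mem_closedBall_zero_iff]
      by_cases hy : ‖q.1‖ ≤ 1
      · simp [ballIndicator_of_le hy, hy]
      · simp [ballIndicator_of_not_le hy, hy]
    rw [h1]
    exact (convex_closedBall _ _).prod (convex_Ici _)
  isClosed_dom := by
    rw [dom_ballIndicator]
    exact Metric.isClosed_closedBall
  isBounded_dom := by
    rw [dom_ballIndicator]
    exact Metric.isBounded_closedBall
  locallyLipschitz := by
    have h1 : LipschitzOnWith 0 (fun y : Vec e => (ballIndicator e y).toReal)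
        (dom (ballIndicator e)) := by
      refine LipschitzOnWith.of_dist_le_mul fun y hy w hw => ?_
      rw [dom_ballIndicator, mem_closedBall_zero_iff] at hy hw
      simp [ballIndicator_of_le hy, ballIndicator_of_le hw]
    exact fun y _ => ⟨0, _, self_mem_nhdsWithin, h1⟩

lemma hasGradientAt_negHalfSq (x : Mat d r) (y : Vec e) :
    HasGradientAt (fun y' => negHalfSq d r e x y') (-y) y := by
  have h1 := ((hasFDerivAt_id (𝕜 := ℝ) y).norm_sq).const_mul (-(1 / 2) : ℝ)
  refine h1.congr_fderiv ?_
  ext v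
  simp only [_root_.smul_apply, ContinuousLinearMap.comp_apply,
    InnerProductSpace.toDual_apply_apply, innerSL_apply_apply, smul_eq_mul,
    nsmul_eq_mul, ContinuousLinearMap.id_apply, id, inner_neg_left]
  push_cast
  ring

lemma gradY_negHalfSq (x : Mat d r) (y : Vec e) : gradY (negHalfSq d r e) x y = -y :=
  (hasGradientAt_negHalfSq x y).gradient

lemma gradX_negHalfSq (x : Mat d r) (y : Vec e) : gradX (negHalfSq d r e) x y = 0 := by
  simp [gradX, gradient, negHalfSq]

/-- A unit vector. -/
lemma exists_norm_eq_one (he : 0 < e) : ∃ a : Vec e, ‖a‖ = 1 :=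
  ⟨EuclideanSpace.single ⟨0, he⟩ 1, by simp⟩

lemma isInstance_negHalfSq (he : 0 < e) (C : ℝ) :
    IsInstance C (negHalfSq d r e) (ballIndicator e) where
  regularizer := isRegularizer_ballIndicator
  nontrivial_dom := by
    obtain ⟨a, ha⟩ := exists_norm_eq_one he
    rw [dom_ballIndicator]
    refine ⟨0, by simp, a, by simp [ha], ?_⟩
    rintro rfl
    simp at ha
  smooth := by
    refine ⟨⟨Set.univ, isOpen_univ, Set.subset_univ _, ?_⟩, 0, 0, 0, 1, le_rfl, le_rfl, le_rfl,
      zero_le_one, fun x₁ _ x₂ _ y₁ _ y₂ _ => ?_⟩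
    · have : Differentiable ℝ fun q : Mat d r × Vec e => -(1 / 2) * ‖q.2‖ ^ 2 :=
        (differentiable_snd.norm_sq ℝ).const_mul _
      exact this.differentiableOn
    · rw [gradX_negHalfSq, gradX_negHalfSq, gradY_negHalfSq, gradY_negHalfSq,
        neg_sub_neg, norm_sub_rev y₂]
      simp
  concave := by
    intro x _ y _ w _
    have e1 : w = y + (w - y) := by abel
    rw [gradY_negHalfSq, inner_neg_left, negHalfSq, negHalfSq]
    conv_lhs => rw [e1, norm_add_sq_real]
    linarith [sq_nonneg ‖w - y‖]

lemma eq_of_isProx_ballIndicator {τ : ℝ} (hτ : 0 < τ) {u p : Vec e} (hu : ‖u‖ ≤ 1)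
    (hp : IsProx τ (ballIndicator e) u p) : p = u := by
  have h1 := isRegularizer_ballIndicator.mem_dom_of_isProx hτ hp
  rw [dom_ballIndicator, mem_closedBall_zero_iff] at h1
  have h2 := hp u
  rw [ballIndicator_of_le h1, ballIndicator_of_le hu, mul_zero, zero_add, zero_add, sub_self,
    EReal.coe_le_coe_iff, norm_zero] at h2
  have h3 : ‖p - u‖ ^ 2 ≤ 0 := by linarith
  exact sub_eq_zero.1 (norm_eq_zero.1
    (pow_eq_zero_iff two_ne_zero |>.1 (le_antisymm h3 (sq_nonneg _))))

lemma eq_zero_of_zero_mem_dualResidual {x : Mat d r} {y : Vec e} (hy : y ∈ dom (ballIndicator e))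
    (h0 : (0 : Vec e) ∈ dualResidual (negHalfSq d r e) (ballIndicator e) x y) : y = 0 := by
  obtain ⟨g, hg, hg0⟩ := h0
  simp only [gradY_negHalfSq, neg_neg] at hg0
  have h1 := hg 0
  rw [dom_ballIndicator, mem_closedBall_zero_iff] at hy
  rw [ballIndicator_of_le hy, ballIndicator_of_le (by simp), zero_add, zero_sub,
    inner_neg_right, eq_neg_of_add_eq_zero_right hg0, inner_neg_left, neg_neg,
    real_inner_self_eq_norm_sq] at h1
  have h2 : ‖y‖ ^ 2 ≤ 0 := by exact_mod_cast h1
  exact norm_eq_zero.1 (pow_eq_zero_iff two_ne_zero |>.1 (le_antisymm h2 (sq_nonneg _)))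

/-- The dual iterates converge to the maximizer of the regularized function. -/
lemma tendsto_dual_of_isRun (he : 0 < e) {C : ℝ} (hC : 0 ≤ C) {a : Vec e} (ha : ‖a‖ = 1)
    {μ ρ l s α ε : ℝ} (hε : 0 < ε)
    (hμ : μ = ε / (2 * Metric.diam (dom (ballIndicator e)))) (hl : 0 < l)
    (hlip : IsPenLip C (tikhonov (negHalfSq d r e) (ballIndicator e) a ε) (ballIndicator e) ρ l)
    (hs : 0 < s) (hs3 : s ≤ 1 / 3) {x : ℕ → Mat d r} {y : ℕ → Vec e} {z : ℕ → Mat d r}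
    (hrun : IsRun C (tikhonov (negHalfSq d r e) (ballIndicator e) a ε) (ballIndicator e)
      μ ρ l s α x y z) :
    Filter.Tendsto y Filter.atTop (nhds ((μ / (1 + μ)) • a)) := by
  have hI := isInstance_negHalfSq (d := d) (r := r) he C
  have hD := hI.diam_pos
  have hμ0 : 0 < μ := by rw [hμ]; positivity
  have hg : ∀ (x : Mat d r) (y : Vec e),
      gradY (tikhonov (negHalfSq d r e) (ballIndicator e) a ε) x y = -y - μ • (y - a) := by
    intro x y
    rw [gradY_tikhonov _ _ _ (hasGradientAt_negHalfSq x y).differentiableAt, gradY_negHalfSq, hμ]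
  have hl1 : 1 + μ ≤ l := by
    have hx0 : (0 : Mat d r) ∈ ballX d r C := by simpa [ballX] using hC
    have h1 := (hlip 0 hx0 0 hx0 a (by simp [dom_ballIndicator, ha]) 0
      (by simp [dom_ballIndicator])).2
    rw [gradY_penalized, gradY_penalized, hg, hg] at h1
    have e1 : -a - μ • (a - a) - (-0 - μ • (0 - a)) = (-(1 + μ)) • a := by module
    rw [e1, norm_smul, ha, Real.norm_eq_abs, abs_neg, abs_of_pos (by linarith)] at h1
    simpa [ha] using h1
  obtain ⟨τ, hτdef⟩ : ∃ τ : ℝ, τ = 1 / 16 * (3 / (s / l))⁻¹ := ⟨_, rfl⟩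
  have hτ : 0 < τ := by rw [hτdef]; positivity
  have hτ1 : τ * (1 + μ) < 1 := by
    calc τ * (1 + μ) ≤ τ * l := by gcongr
      _ = s / 48 := by
        rw [hτdef]
        field_simp
        norm_num
      _ < 1 := by linarith
  have hk0 : 0 ≤ 1 - τ * (1 + μ) := by linarith
  have hτμ : 0 < τ * μ := by positivity
  have hstep : ∀ t, ‖y t‖ ≤ 1 → y (t + 1) = (1 - τ * (1 + μ)) • y t + (τ * μ) • a := by
    intro t ht
    have h1 := hrun.2.y_step t
    rw [← hτdef, hg] at h1
    have e1 : y t + τ • (-y t - μ • (y t - a) - (0 : ℝ) • y t)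
        = (1 - τ * (1 + μ)) • y t + (τ * μ) • a := by module
    rw [e1] at h1
    refine eq_of_isProx_ballIndicator hτ ?_ h1
    refine (norm_add_le _ _).trans ?_
    rw [norm_smul, norm_smul, Real.norm_of_nonneg hk0, Real.norm_of_nonneg hτμ.le, ha]
    nlinarith
  have hball : ∀ t, ‖y t‖ ≤ 1 := by
    intro t
    induction t with
    | zero =>
      have := hrun.1.2.1.1
      rwa [dom_ballIndicator, mem_closedBall_zero_iff] at this
    | succ t ih =>
      rw [hstep t ih]
      refine (norm_add_le _ _).trans ?_
      rw [norm_smul, norm_smul, Real.norm_of_nonneg hk0, Real.norm_of_nonneg hτμ.le, ha]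
      nlinarith
  have hform : ∀ t, y t = (μ / (1 + μ)) • a
      + (1 - τ * (1 + μ)) ^ t • (y 0 - (μ / (1 + μ)) • a) := by
    intro t
    induction t with
    | zero => simp
    | succ t ih =>
      rw [hstep t (hball t), ih, pow_succ]
      have e1 : τ * μ = τ * (1 + μ) * (μ / (1 + μ)) := by field_simp
      rw [e1]
      module
  have hpow : Filter.Tendsto (fun t : ℕ => (1 - τ * (1 + μ)) ^ t) Filter.atTop (nhds 0) :=
    tendsto_pow_atTop_nhds_zero_of_lt_one hk0 (by nlinarith)
  have hlim := (hpow.smul_const (y 0 - (μ / (1 + μ)) • a)).const_add ((μ / (1 + μ)) • a)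
  rw [zero_smul, add_zero] at hlim
  exact hlim.congr fun t => (hform t).symm

/-- Every run on the counterexample has limit points, and none of them is stationary. -/
theorem not_isStationary_of_mapClusterPt (he : 0 < e) {C : ℝ}
    (hC : sSup ((fun x => ‖x‖) '' stiefel d r) ≤ C) {a : Vec e} (ha : ‖a‖ = 1)
    {ρ l s α ε : ℝ} (hε : 0 < ε) (hl : 0 < l)
    (hlip : IsPenLip C (tikhonov (negHalfSq d r e) (ballIndicator e) a ε) (ballIndicator e) ρ l)
    (hs : 0 < s) (hs3 : s ≤ 1 / 3) {x : ℕ → Mat d r} {y : ℕ → Vec e} {z : ℕ → Mat d r}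
    (hrun : IsRun C (tikhonov (negHalfSq d r e) (ballIndicator e) a ε) (ballIndicator e)
      (ε / (2 * Metric.diam (dom (ballIndicator e)))) ρ l s α x y z) :
    (∃ w, MapClusterPt w Filter.atTop fun t => (x t, y t)) ∧
      ∀ w, MapClusterPt w Filter.atTop (fun t => (x t, y t)) →
        ¬IsStationary (negHalfSq d r e) (ballIndicator e) w.1 w.2 := by
  have hI := isInstance_negHalfSq (d := d) (r := r) he C
  have hD := hI.diam_pos
  have hsup : 0 ≤ sSup ((fun x : Mat d r => ‖x‖) '' stiefel d r) :=
    Real.sSup_nonneg (by rintro _ ⟨x, -, rfl⟩; exact norm_nonneg x)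
  have hlim := tendsto_dual_of_isRun he (hsup.trans hC) ha hε rfl hl hlip hs hs3 hrun
  set μ := ε / (2 * Metric.diam (dom (ballIndicator e)))
  have hμ : 0 < μ := by positivity
  constructor
  · have hx : ∀ t, x t ∈ ballX d r C := fun t => by
      cases t with
      | zero => exact mem_ballX_of_isInit (stiefel_subset_ballX hC) hrun.1
      | succ t => exact (hrun.2.x_step t).1
    have hy : ∀ t, y t ∈ dom (ballIndicator e) := fun t => by
      cases t with
      | zero => exact hrun.1.2.1.1
      | succ t =>
        have hτ : 0 < (1 / 16 * (3 / (s / l))⁻¹ : ℝ) := by positivity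
        exact isRegularizer_ballIndicator.mem_dom_of_isProx hτ (hrun.2.y_step t)
    obtain ⟨w, -, hw⟩ := (isCompact_ballX.prod
      isRegularizer_ballIndicator.isCompact_dom).exists_mapClusterPt (f := Filter.atTop)
        (u := fun t => (x t, y t)) (Filter.tendsto_principal.2
          (Filter.Eventually.of_forall fun t => ⟨hx t, hy t⟩))
    exact ⟨w, hw⟩
  · rintro w hw ⟨-, hwd, -, h0⟩
    have h1 : MapClusterPt w.2 Filter.atTop y := hw.continuousAt_comp continuousAt_snd
    have h2 : w.2 = (μ / (1 + μ)) • a := by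
      have h3 : (nhds w.2 ⊓ nhds ((μ / (1 + μ)) • a)).NeBot :=
        h1.neBot.mono (inf_le_inf_left _ hlim)
      exact eq_of_nhds_neBot h3
    have h3 := eq_zero_of_zero_mem_dualResidual hwd h0
    rw [h3, eq_comm, smul_eq_zero] at h2
    rcases h2 with h2 | h2
    · have : 0 < μ / (1 + μ) := by positivity
      linarith
    · simp [h2] at ha

end Counterexample

end SmMGDA

end

theorem mainTheorem6 (d₁ r d₂ : ℕ) (C : ℝ)
    (hC : 1 / 2 + sSup ((fun x => ‖x‖) '' SmMGDA.stiefel d₁ r) < C) :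
    -- every instance of the nonconvex--merely-concave problem
    (∀ (f : SmMGDA.Mat d₁ r → SmMGDA.Vec d₂ → ℝ) (h : SmMGDA.Vec d₂ → EReal),
      SmMGDA.IsInstance C f h → ∀ a ∈ SmMGDA.dom h,
      -- the regularized problem is strongly concave in `y` with modulus `ε / (2 D)`
      (∀ ε > 0, ∀ x ∈ SmMGDA.barX d₁ r C,
        StrongConcaveOn (SmMGDA.dom h) (ε / (2 * Metric.diam (SmMGDA.dom h)))
          fun y => SmMGDA.tikhonov f h a ε x y - (h y).toReal) ∧
      -- Lipschitz constants of the penalized gradient, before and after regularization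
      (∀ ρ > 0, (∃ l > 0, SmMGDA.IsPenLip C f h ρ l) ∧
        ∀ l > 0, SmMGDA.IsPenLip C f h ρ l → ∀ ε > 0,
          SmMGDA.IsPenLip C (SmMGDA.tikhonov f h a ε) h ρ
            (l + ε / (2 * Metric.diam (SmMGDA.dom h)))) ∧
      -- the complexity bound
      (∀ ε₀ > 0, ∀ z₀ ∈ SmMGDA.stiefel d₁ r, ∃ ρbar > 0,
        ∀ s : ℝ, 0 < s → s ≤ 1 / 3 → ∀ α : ℝ, 0 < α → α < 1 / 2306 → ∃ K > 0,
        ∀ ρ ≥ ρbar, ∀ ε : ℝ, 0 < ε → ε ≤ ε₀ →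
        ∀ l > 0, SmMGDA.IsPenLip C (SmMGDA.tikhonov f h a ε) h ρ l →
          (∃ x y z, z 0 = z₀ ∧
            SmMGDA.IsRun C (SmMGDA.tikhonov f h a ε) h
              (ε / (2 * Metric.diam (SmMGDA.dom h))) ρ l s α x y z) ∧
          ∀ x y z, z 0 = z₀ →
            SmMGDA.IsRun C (SmMGDA.tikhonov f h a ε) h
              (ε / (2 * Metric.diam (SmMGDA.dom h))) ρ l s α x y z →
            ∃ t : ℕ, (t : ℝ) ≤ K * l ^ 2 / ε ^ 3 ∧
              ∃ q, (∀ q', SmMGDA.IsProj (SmMGDA.stiefel d₁ r) (x t) q' ↔ q' = q) ∧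
                ‖x t - q‖ ≤ 3 / ρ * ε ∧ SmMGDA.IsEpsStationary f h ε q (y t))) ∧
    -- asymptotic stationarity for the original problem is lost
    (0 < d₂ → ∃ (f : SmMGDA.Mat d₁ r → SmMGDA.Vec d₂ → ℝ) (h : SmMGDA.Vec d₂ → EReal),
      SmMGDA.IsInstance C f h ∧ ∃ a ∈ SmMGDA.dom h,
        ∀ ε > 0, ∀ ρ > 0, ∀ l > 0, SmMGDA.IsPenLip C (SmMGDA.tikhonov f h a ε) h ρ l →
        ∀ s : ℝ, 0 < s → s ≤ 1 / 3 → ∀ α : ℝ, 0 < α → α < 1 / 2306 →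
        ∀ x y z,
          SmMGDA.IsRun C (SmMGDA.tikhonov f h a ε) h
            (ε / (2 * Metric.diam (SmMGDA.dom h))) ρ l s α x y z →
          (∃ w, MapClusterPt w Filter.atTop fun t => (x t, y t)) ∧
          ∀ w, MapClusterPt w Filter.atTop (fun t => (x t, y t)) →
            ¬ SmMGDA.IsStationary f h w.1 w.2) := by
  have hsup : 0 ≤ sSup ((fun x : SmMGDA.Mat d₁ r => ‖x‖) '' SmMGDA.stiefel d₁ r) :=
    Real.sSup_nonneg (by rintro _ ⟨x, -, rfl⟩; exact norm_nonneg x)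
  have hC0 : 0 ≤ C := by linarith
  refine ⟨fun f h hI a ha => ⟨fun ε _ x hx => hI.strongConcaveOn a ε hx,
    fun ρ _ => ⟨hI.exists_isPenLip ρ, fun l _ hl ε hε => hI.isPenLip_tikhonov a hε hl⟩,
    fun ε₀ hε₀ z₀ hz₀ => ?_⟩, fun he => ?_⟩
  · obtain ⟨ρbar, hρbar, H⟩ := hI.complexity hC ha hε₀
    refine ⟨ρbar, hρbar, fun s hs hs3 α hα hα1 => ?_⟩
    obtain ⟨K, hK, H⟩ := H s hs hs3 α hα hα1
    refine ⟨K, hK, fun ρ hρ ε hε hεε₀ l hl hlip => ⟨?_, fun x y z _ hrun =>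
      H ρ hρ ε hε hεε₀ l hl hlip x y z hrun⟩⟩
    have P := hI.isSaddleProblem hC0 a hε hl hlip
    exact SmMGDA.exists_run hI.regularizer P.nonempty_X hl hs
      (SmMGDA.isInit_argY hI.regularizer P hz₀)
  · obtain ⟨a, ha⟩ := SmMGDA.exists_norm_eq_one he
    refine ⟨SmMGDA.negHalfSq d₁ r d₂, SmMGDA.ballIndicator d₂,
      SmMGDA.isInstance_negHalfSq he C, a, by simp [SmMGDA.dom_ballIndicator, ha], ?_⟩
    intro ε hε ρ _ l hl hlip s hs hs3 α _ _ x y z hrun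
    exact SmMGDA.not_isStationary_of_mapClusterPt he (by linarith) ha hε hl hlip hs hs3 hrun
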